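/- Let $X=\{X_s\}_{s\ge 0}$ be a one-dimensional symmetric Lévy process started at $0$, with characteristic exponent $\Psi:\mathbb R\to[0,\infty)$, i.e. $\mathbb E[e^{-ixX_s}]=e^{-s\Psi(x)}$ for all $s\ge 0$, $x\in\mathbb R$. Assume that $\Psi(x)=\Psi(|x|)$, that $\Psi$ is non-decreasing on $[0,\infty)$, and that $$\lim_{x\to0^+}\frac{\Psi(x)}{x^2}=\ell\in(0,\infty),\qquad \lim_{x\to\infty}\frac{\Psi(x)}{\ln(|x|+1)}=\infty,\qquad \int_{\mathbb R}\frac{dx}{1+\Psi(x)}<\infty .$$ For $\delta>0$ put $\underline{\ell}(\delta)=\inf_{0<|x|\le\delta}\Psi(x)/x^2$. Let $\{a(n)\}_{n\in\mathbb N}$ be a non-decreasing sequence of positive numbers with $a(n)\to\infty$. Let $f:\mathbb R\to\mathbb C$ satisfy $f\in L^1(\mathbb R)\cap L^\infty(\mathbb R)$, $\widehat f\in L^1(\mathbb R)$ and $\int_{\mathbb R}|\widehat f(x)-\widehat f(0)|\,x^{-2}\,dx<\infty$, where $\widehat f(x)=\int_{\mathbb R}e^{-ixy}f(y)\,dy$.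 Fix $t>0$ and set $$I_n(t)=\frac1{a(n)}\int_0^{t^2a(n)^2}f(X_s)\,ds .$$ Then there are random variables $I^{(1)}_{n,\delta}(t)$ (complex-valued) and $I^{(2)}_{n,\delta}(t)$ (real-valued), $n\in\mathbb N$, $\delta>0$, such that $I_n(t)=I^{(1)}_{n,\delta}(t)+\widehat f(0)\,I^{(2)}_{n,\delta}(t)$ for all $n$ and $\delta$, and: (i) for every $\delta>0$, $I^{(1)}_{n,\delta}(t)\to0$ in $L^2$ as $n\to\infty$; (ii) for every $\delta>0$ and every integer $k\ge1$, $$\sup_{n\in\mathbb N}\mathbb E\Big[\big|I^{(2)}_{n,\delta}(t)\big|^{2k}\Big]\le\Big(\frac{t^2}{4\,\underline{\ell}(2k\delta)}\Big)^k\frac{(2k)!}{k!},$$ and the sequence $\{(I^{(2)}_{n,\delta}(t))^k:n\in\mathbb N\}$ is uniformly integrable. Furthermore, for every integer $k\ge1$, $$\lim_{\delta\to0^+}\liminf_{n\to\infty}\mathbb E\Big[\big(I^{(2)}_{n,\delta}(t)\big)^k\Big]=\lim_{\delta\to0^+}\limsup_{n\to\infty}\mathbb E\Big[\big(I^{(2)}_{n,\delta}(t)\big)^k\Big]=\Big(\frac{t}{2\sqrt{\ell}}\Big)^k\frac{k!}{\Gamma(1+k/2)}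 .$$ -/

import Mathlib

open MeasureTheory ProbabilityTheory Filter Topology
open scoped NNReal ENNReal

/-- A one-dimensional Lévy process on `(Ω, P)`: it starts at zero, has independent and stationary
increments, and almost surely its paths are right continuous with left limits. -/
structure IsLevyProcess {Ω : Type*} [MeasurableSpace Ω] (X : ℝ≥0 → Ω → ℝ) (P : Measure Ω) :
    Prop where
  measurable : ∀ t, Measurable (X t)
  start_zero : ∀ᵐ ω ∂P, X 0 ω = 0
  indep_increments : HasIndepIncrements X P
  stationary_increments : ∀ s t : ℝ≥0,
    IdentDistrib (fun ω => X (s + t) ω - X s ω) (X t) P P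
  cadlag : ∀ᵐ ω ∂P, ∀ t : ℝ≥0,
    ContinuousWithinAt (fun s => X s ω) (Set.Ici t) t ∧
      ∃ l : ℝ, Tendsto (fun s => X s ω) (𝓝[<] t) (𝓝 l)

/-- The process is symmetric: `X t` and `-X t` have the same law. -/
def IsSymmetricProcess {Ω : Type*} [MeasurableSpace Ω] (X : ℝ≥0 → Ω → ℝ) (P : Measure Ω) :
    Prop :=
  ∀ t, IdentDistrib (X t) (fun ω => -X t ω) P P

/-- The real function `Ψ` is the characteristic exponent of `X`:
`E [exp (-i x X_s)] = exp (-s Ψ(x))`. -/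
def HasCharExponent {Ω : Type*} [MeasurableSpace Ω] (X : ℝ≥0 → Ω → ℝ) (P : Measure Ω)
    (Ψ : ℝ → ℝ) : Prop :=
  ∀ (s : ℝ≥0) (x : ℝ),
    ∫ ω, Complex.exp (-(Complex.I * (x : ℂ) * (X s ω : ℂ))) ∂P =
      Complex.exp (-(((s : ℝ) : ℂ) * (Ψ x : ℂ)))

/-- The infimum of `Ψ(x) / x²` over `0 < |x| ≤ δ`. -/
noncomputable def ellLower (Ψ : ℝ → ℝ) (δ : ℝ) : ℝ :=
  sInf ((fun x : ℝ => Ψ x / x ^ 2) '' {x : ℝ | x ≠ 0 ∧ |x| ≤ δ})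

/-- The Fourier transform `x ↦ ∫ exp (-i x y) f(y) dy`, in the angular normalization. -/
noncomputable def angularFourier (f : ℝ → ℂ) (x : ℝ) : ℂ :=
  ∫ y : ℝ, Complex.exp (-(Complex.I * (x : ℂ) * (y : ℂ))) * f y

/-- The class of admissible functions: `f ∈ L¹ ∩ L^∞`, its Fourier transform is in `L¹`, and
`|f̂(x) - f̂(0)| / x²` is integrable. -/
structure IsAdmissible (f : ℝ → ℂ) : Prop where
  memLp_one : MemLp f 1 volume
  memLp_top : MemLp f ∞ volume
  fourier_integrable : Integrable (angularFourier f) volume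
  fourier_sub_integrable :
    Integrable (fun x : ℝ => ‖angularFourier f x - angularFourier f 0‖ / x ^ 2) volume

/-- The normalized additive functional `b⁻¹ ∫₀^{t² b²} f(X_s) ds`. -/
noncomputable def additiveFunctional {Ω : Type*} (X : ℝ≥0 → Ω → ℝ) (f : ℝ → ℂ) (b t : ℝ)
    (ω : Ω) : ℂ :=
  (b : ℂ)⁻¹ * ∫ s in (0 : ℝ)..(t ^ 2 * b ^ 2), f (X s.toNNReal ω)

/-! By Fourier inversion, `f` is a superposition of phases `exp (i x y)` with density `(2π)⁻¹
f̂(x)`. Only frequencies near `0` survive the normalization, and there `f̂` may be replaced by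
`f̂(0)`. Hence `f` is split into `f̂(0)` times `sincKernel δ`, whose spectrum is `(2π)⁻¹` on `(-δ,
δ]`, and a remainder with density `residualSpectrum f δ`.

Remainder. Independence of increments bounds the second moment of its integral up to time `T` by
twice the integral of `|κ(y)| / Ψ(y)` against `∫ |κ(x)| truncLaplace T (Ψ (x - y)) dx`. The first
factor is integrable because `f̂(0)` has been subtracted where `1/Ψ` is singular
(`lintegral_residualSpectrum_ne_top`). The second, divided by `a(n)²`, tends to zero by domination
by a multiple of `1 / (1 + Ψ)` (`tendsto_lintegral_truncLaplace`).

Main part. Brownian scaling turns it into the occupation functional, up to time `t²`, of a process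
with exponent `a(n)² Ψ(v / a(n))` and window `(-a(n)δ, a(n)δ]`. Conditioning on the last of `k`
ordered times adds one frequency from the window and one exponential factor, so the `k`-th moment is
`k!` times the iterated integral `chainKernel` (`integral_exp_mul_occupation_pow`). A quadratic
lower bound on the exponent bounds this by the Gaussian chain on the whole line
(`chainKernel_le_chainKernel`), which Beta integrals evaluate (`chainKernel_gaussian_zero`). This
gives the uniform even moments, and it dominates the passage to the limit exponent `ℓ v²` with the
window filling the line (`tendsto_chainKernel`). The moment limit therefore exists for each fixed
`δ` and does not depend on `δ`. -/

/-! ### Chain kernels: comparison, Gaussian evaluation, convergence. -/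

/-- The iterated resolvent-type kernel of the moments of an additive functional: `Φ` is the
characteristic exponent and `S` is the set of admissible frequency increments. -/
noncomputable def chainKernel (Φ : ℝ → ℝ) (S : Set ℝ) : ℕ → ℝ → ℝ → ℝ≥0∞
  | 0, τ, v => ENNReal.ofReal (Real.exp (-(τ * Φ v)))
  | k + 1, τ, v => ∫⁻ σ in Set.Ioc 0 τ, ENNReal.ofReal (Real.exp (-((τ - σ) * Φ v))) *
      (ENNReal.ofReal (2 * Real.pi)⁻¹ * ∫⁻ x in S, chainKernel Φ S k σ (v + x))

theorem measurable_chainKernel {Φ : ℝ → ℝ} (hΦ : Measurable Φ) (S : Set ℝ) (k : ℕ) :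
    Measurable (fun p : ℝ × ℝ => chainKernel Φ S k p.1 p.2) := by
  induction k with
  | zero => simp only [chainKernel]; fun_prop
  | succ k ih =>
    have hin : Measurable (fun p : ℝ × ℝ => ∫⁻ x in S, chainKernel Φ S k p.1 (p.2 + x)) := by
      have : Measurable (fun q : (ℝ × ℝ) × ℝ => chainKernel Φ S k q.1.1 (q.1.2 + q.2)) :=
        ih.comp (f := fun q : (ℝ × ℝ) × ℝ => (q.1.1, q.1.2 + q.2)) (by fun_prop)
      exact this.lintegral_prod_right'
    -- The domain `(0, τ]` depends on the parameter; as an indicator it becomes part of a jointly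
    -- measurable integrand over a fixed measure.
    have hfull : Measurable (fun q : (ℝ × ℝ) × ℝ =>
        {q : (ℝ × ℝ) × ℝ | 0 < q.2 ∧ q.2 ≤ q.1.1}.indicator (fun q : (ℝ × ℝ) × ℝ =>
          ENNReal.ofReal (Real.exp (-((q.1.1 - q.2) * Φ q.1.2))) *
          (ENNReal.ofReal (2 * Real.pi)⁻¹ *
            ∫⁻ x in S, chainKernel Φ S k q.2 (q.1.2 + x))) q) := by
      refine Measurable.indicator ?_ ?_
      · have h2 : Measurable (fun q : (ℝ × ℝ) × ℝ =>
            ∫⁻ x in S, chainKernel Φ S k q.2 (q.1.2 + x)) :=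
          hin.comp (g := fun p : ℝ × ℝ => ∫⁻ x in S, chainKernel Φ S k p.1 (p.2 + x))
            (f := fun q : (ℝ × ℝ) × ℝ => (q.2, q.1.2)) (by fun_prop)
        fun_prop
      · exact (measurableSet_lt measurable_const measurable_snd).inter
          (measurableSet_le measurable_snd (by fun_prop))
    convert hfull.lintegral_prod_right' (ν := volume) using 2 with p
    rw [chainKernel, ← lintegral_indicator measurableSet_Ioc]
    rfl

theorem measurable_chainKernel_inner {Φ : ℝ → ℝ} (hΦ : Measurable Φ) (S : Set ℝ) (k : ℕ) :
    Measurable (fun p : ℝ × ℝ => ∫⁻ x in S, chainKernel Φ S k p.1 (p.2 + x)) := by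
  have : Measurable (fun q : (ℝ × ℝ) × ℝ => chainKernel Φ S k q.1.1 (q.1.2 + q.2)) :=
    (measurable_chainKernel hΦ S k).comp
      (g := fun p : ℝ × ℝ => chainKernel Φ S k p.1 p.2)
      (f := fun q : (ℝ × ℝ) × ℝ => (q.1.1, q.1.2 + q.2)) (by fun_prop)
  exact this.lintegral_prod_right'

/-- Each step costs at most a factor `T |S| / (2π)`, since the exponentials are at most one.
Finiteness is what allows passing between `lintegral` and Bochner integrals in the moment formula.
-/
theorem exists_chainKernel_le {Φ : ℝ → ℝ} (hΦ : ∀ x, 0 ≤ Φ x) {S : Set ℝ} (hS : volume S ≠ ∞)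
    (T : ℝ) (k : ℕ) :
    ∃ C : ℝ≥0∞, C ≠ ∞ ∧ ∀ τ, 0 ≤ τ → τ ≤ T → ∀ v, chainKernel Φ S k τ v ≤ C := by
  have hexp : ∀ s v, 0 ≤ s → ENNReal.ofReal (Real.exp (-(s * Φ v))) ≤ 1 := by
    intro s v hs
    rw [ENNReal.ofReal_le_one, Real.exp_le_one_iff]
    have := mul_nonneg hs (hΦ v)
    linarith
  induction k with
  | zero => exact ⟨1, by simp, fun τ h0 _ v => hexp τ v h0⟩
  | succ k ih =>
    obtain ⟨C, hC, h⟩ := ih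
    refine ⟨ENNReal.ofReal T * (ENNReal.ofReal (2 * Real.pi)⁻¹ * (C * volume S)),
      by finiteness, fun τ h0 hT v => ?_⟩
    rw [chainKernel]
    calc _ ≤ ∫⁻ σ in Set.Ioc 0 τ, ENNReal.ofReal (2 * Real.pi)⁻¹ * (C * volume S) := by
          refine setLIntegral_mono measurable_const fun σ hσ => ?_
          rw [← one_mul (ENNReal.ofReal (2 * Real.pi)⁻¹ * (C * volume S))]
          gcongr
          · exact hexp _ _ (sub_nonneg.2 hσ.2)
          · rw [← setLIntegral_const]
            exact setLIntegral_mono measurable_const fun x _ => h σ hσ.1.le (hσ.2.trans hT) _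
      _ ≤ _ := by
          rw [setLIntegral_const, mul_comm]
          gcongr
          simpa using ENNReal.ofReal_le_ofReal hT

/-- A step moves the frequency by at most `d`, so a chain of `k` steps started within `(M - k) d` of
the origin never leaves `|v| ≤ M d`. The exponents need comparison only there, and enlarging the set
of increments only increases the integrals. -/
theorem chainKernel_le_chainKernel {Φ Φ' : ℝ → ℝ} {S : Set ℝ} {d : ℝ} (hd : 0 ≤ d)
    (hS : MeasurableSet S) (hS' : ∀ x ∈ S, |x| ≤ d) {M : ℕ}
    (hle : ∀ v, |v| ≤ M * d → Φ' v ≤ Φ v) {k : ℕ} (hk : k ≤ M) {τ v : ℝ} (hτ : 0 ≤ τ)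
    (hv : |v| ≤ ((M - k : ℕ) : ℝ) * d) :
    chainKernel Φ S k τ v ≤ chainKernel Φ' Set.univ k τ v := by
  have hexp : ∀ s v, 0 ≤ s → |v| ≤ M * d → ENNReal.ofReal (Real.exp (-(s * Φ v))) ≤
      ENNReal.ofReal (Real.exp (-(s * Φ' v))) := by
    intro s v hs hv
    gcongr
    exact hle v hv
  have hMk : ∀ k : ℕ, ((M - k : ℕ) : ℝ) * d ≤ M * d := fun k => by
    gcongr
    exact Nat.sub_le _ _
  induction k generalizing τ v with
  | zero => exact hexp _ _ hτ (by simpa using hv)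
  | succ k ih =>
    rw [chainKernel, chainKernel]
    refine setLIntegral_mono' measurableSet_Ioc fun σ hσ => ?_
    gcongr ?_ * (_ * ?_)
    · exact hexp _ _ (sub_nonneg.2 hσ.2) (hv.trans (hMk _))
    · calc _ ≤ ∫⁻ x in S, chainKernel Φ' Set.univ k σ (v + x) := by
            refine setLIntegral_mono' hS fun x hx => ih (by omega) hσ.1.le ?_
            have h1 : ((M - k : ℕ) : ℝ) = ((M - (k + 1) : ℕ) : ℝ) + 1 := by
              have : M - k = M - (k + 1) + 1 := by omega
              rw [this]; push_cast; ring
            calc |v + x| ≤ |v| + |x| := abs_add_le _ _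
              _ ≤ ((M - (k + 1) : ℕ) : ℝ) * d + d := add_le_add hv (hS' x hx)
              _ = _ := by rw [h1]; ring
        _ ≤ _ := lintegral_mono' (Measure.restrict_mono (Set.subset_univ _) le_rfl) le_rfl

theorem lintegral_rpow_mul_sub_rpow {α β τ : ℝ} (hα : 0 < α) (hβ : 0 < β) (hτ : 0 < τ) :
    ∫⁻ σ in Set.Ioc 0 τ, ENNReal.ofReal (σ ^ (α - 1) * (τ - σ) ^ (β - 1)) =
      ENNReal.ofReal (τ ^ (α + β - 1) *
        (Real.Gamma α * Real.Gamma β / Real.Gamma (α + β))) := by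
  have hcongr : ∀ x ∈ Set.Ioc 0 τ, (x : ℂ) ^ ((α : ℂ) - 1) * ((τ : ℂ) - x) ^ ((β : ℂ) - 1) =
      ((x ^ (α - 1) * (τ - x) ^ (β - 1) : ℝ) : ℂ) := by
    intro x hx
    push_cast [Complex.ofReal_cpow hx.1.le, Complex.ofReal_cpow (sub_nonneg.2 hx.2)]
    rfl
  have hval := Complex.betaIntegral_scaled α β hτ
  rw [Complex.betaIntegral_eq_Gamma_mul_div _ _ (by simpa) (by simpa)] at hval
  rw [intervalIntegral.integral_of_le hτ.le, setIntegral_congr_fun measurableSet_Ioc hcongr,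
    integral_complex_ofReal] at hval
  have hreal : ∫ x in Set.Ioc 0 τ, x ^ (α - 1) * (τ - x) ^ (β - 1) =
      τ ^ (α + β - 1) * (Real.Gamma α * Real.Gamma β / Real.Gamma (α + β)) := by
    have h2 : ((τ : ℂ) ^ ((α : ℂ) + β - 1)) = ((τ ^ (α + β - 1) : ℝ) : ℂ) := by
      push_cast [Complex.ofReal_cpow hτ.le]; rfl
    rw [h2, ← Complex.ofReal_add, Complex.Gamma_ofReal, Complex.Gamma_ofReal,
      Complex.Gamma_ofReal] at hval
    exact_mod_cast hval
  -- A nonzero Bochner integral forces integrability, so no separate integrability proof is needed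
  -- at the two endpoint singularities.
  have hne : ∫ x in Set.Ioc 0 τ, x ^ (α - 1) * (τ - x) ^ (β - 1) ≠ 0 := by
    rw [hreal]
    have := Real.Gamma_pos_of_pos hα
    have := Real.Gamma_pos_of_pos hβ
    have := Real.Gamma_pos_of_pos (add_pos hα hβ)
    positivity
  rw [← ofReal_integral_eq_lintegral_ofReal (not_imp_comm.1 integral_undef hne), hreal]
  filter_upwards [ae_restrict_mem measurableSet_Ioc] with x hx
  have := hx.1
  have := sub_nonneg.2 hx.2
  positivity

theorem lintegral_exp_neg_mul_sq {b : ℝ} (hb : 0 < b) :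
    ∫⁻ x : ℝ, ENNReal.ofReal (Real.exp (-(b * x ^ 2))) = ENNReal.ofReal (√(Real.pi / b)) := by
  rw [← integral_gaussian, ofReal_integral_eq_lintegral_ofReal]
  · simp
  · exact integrable_exp_neg_mul_sq hb
  · exact ae_of_all _ fun x => (Real.exp_pos _).le

/-- The integral of the Gaussian chain kernel over all frequencies. -/
theorem lintegral_chainKernel_gaussian {b : ℝ} (hb : 0 < b) (k : ℕ) {τ : ℝ} (hτ : 0 < τ) :
    ENNReal.ofReal (2 * Real.pi)⁻¹ *
        ∫⁻ x, chainKernel (fun v => b * v ^ 2) Set.univ k τ x =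
      ENNReal.ofReal ((1 / (2 * √b)) ^ (k + 1) / Real.Gamma ((k + 1) / 2) *
        τ ^ (((k : ℝ) + 1) / 2 - 1)) := by
  -- Writing `√π` as `Γ(1/2)` puts the one-step Gaussian integral in the form that the Beta
  -- recursion reproduces.
  have hsq : ∀ s : ℝ, 0 < s → (2 * Real.pi)⁻¹ * √(Real.pi / (s * b)) =
      (1 / (2 * √b)) / Real.Gamma (1 / 2) * s ^ ((1 : ℝ) / 2 - 1) := by
    intro s hs
    have h1 : s ^ ((1 : ℝ) / 2 - 1) = 1 / √s := by
      rw [show (1 : ℝ) / 2 - 1 = -(1 / 2) by norm_num, Real.rpow_neg hs.le, ← Real.sqrt_eq_rpow,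
        one_div]
    rw [h1, Real.Gamma_one_half_eq, Real.sqrt_div Real.pi_pos.le, Real.sqrt_mul hs.le]
    have hp : √Real.pi ^ 2 = Real.pi := Real.sq_sqrt Real.pi_pos.le
    have : 0 < √Real.pi := Real.sqrt_pos.2 Real.pi_pos
    have : 0 < √s := Real.sqrt_pos.2 hs
    have : 0 < √b := Real.sqrt_pos.2 hb
    field_simp
    rw [hp]
  have hgauss : ∀ s : ℝ, 0 < s → ENNReal.ofReal (2 * Real.pi)⁻¹ *
      ∫⁻ x : ℝ, ENNReal.ofReal (Real.exp (-(s * (b * x ^ 2)))) =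
      ENNReal.ofReal ((1 / (2 * √b)) / Real.Gamma (1 / 2) * s ^ ((1 : ℝ) / 2 - 1)) := by
    intro s hs
    simp_rw [← mul_assoc]
    rw [lintegral_exp_neg_mul_sq (mul_pos hs hb), ← ENNReal.ofReal_mul (by positivity), hsq s hs]
  induction k generalizing τ with
  | zero => simpa [chainKernel] using hgauss τ hτ
  | succ k ih =>
    have hΦ : Measurable (fun v : ℝ => b * v ^ 2) := by fun_prop
    obtain ⟨G, hG⟩ : ∃ G : ℝ → ℝ≥0∞, ∀ σ, G σ = ENNReal.ofReal (2 * Real.pi)⁻¹ *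
        ∫⁻ x, chainKernel (fun v => b * v ^ 2) Set.univ k σ x := ⟨_, fun _ => rfl⟩
    have hGm : Measurable G := by
      rw [funext hG]
      exact (measurable_chainKernel hΦ Set.univ k).lintegral_prod_right'.const_mul _
    -- On the whole line the inner integral is translation invariant, hence independent of the
    -- current frequency: the recursion reduces to a convolution in time.
    have hunf : ∀ x, chainKernel (fun v => b * v ^ 2) Set.univ (k + 1) τ x =
        ∫⁻ σ in Set.Ioc 0 τ, ENNReal.ofReal (Real.exp (-((τ - σ) * (b * x ^ 2)))) * G σ := by
      intro x
      rw [chainKernel]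
      refine lintegral_congr fun σ => ?_
      rw [Measure.restrict_univ, hG,
        lintegral_add_left_eq_self (fun x => chainKernel (fun v => b * v ^ 2) Set.univ k σ x)]
    rw [lintegral_congr hunf]
    have hm2 : Measurable (fun p : ℝ × ℝ =>
        ENNReal.ofReal (Real.exp (-((τ - p.1) * (b * p.2 ^ 2)))) * G p.1) := by fun_prop
    rw [lintegral_lintegral_swap (f := fun x σ =>
        ENNReal.ofReal (Real.exp (-((τ - σ) * (b * x ^ 2)))) * G σ)
        (hm2.comp measurable_swap).aemeasurable,
      ← lintegral_const_mul _ hm2.lintegral_prod_right']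
    have hΓ : 0 < Real.Gamma (((k : ℝ) + 1) / 2) := Real.Gamma_pos_of_pos (by positivity)
    have hΓ' : 0 < Real.Gamma (1 / 2) := Real.Gamma_pos_of_pos (by positivity)
    set D : ℝ := (1 / (2 * √b)) / Real.Gamma (1 / 2) *
      ((1 / (2 * √b)) ^ (k + 1) / Real.Gamma ((k + 1) / 2)) with hD
    have hD0 : 0 ≤ D := by positivity
    have hstep : ∀ᵐ σ ∂(volume.restrict (Set.Ioc 0 τ)), ENNReal.ofReal (2 * Real.pi)⁻¹ *
        ∫⁻ x : ℝ, ENNReal.ofReal (Real.exp (-((τ - σ) * (b * x ^ 2)))) * G σ =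
        ENNReal.ofReal D *
          ENNReal.ofReal (σ ^ (((k : ℝ) + 1) / 2 - 1) * (τ - σ) ^ ((1 : ℝ) / 2 - 1)) := by
      -- At `σ = τ` the Gaussian has no decay and its integral is not given by the formula.
      have hne : ∀ᵐ σ ∂(volume.restrict (Set.Ioc 0 τ)), σ ≠ τ :=
        ae_restrict_of_ae (by simp [ae_iff])
      filter_upwards [ae_restrict_mem measurableSet_Ioc, hne] with σ hσ hστ
      have hpos : 0 < τ - σ := sub_pos.2 (lt_of_le_of_ne hσ.2 hστ)
      have hσ0 := hσ.1
      rw [lintegral_mul_const _ (by fun_prop), ← mul_assoc, hgauss _ hpos, hG, ih hσ.1,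
        ← ENNReal.ofReal_mul (by positivity), ← ENNReal.ofReal_mul hD0, hD]
      congr 1
      ring
    rw [lintegral_congr_ae hstep, lintegral_const_mul _ (by fun_prop),
      lintegral_rpow_mul_sub_rpow (by positivity) (by norm_num) hτ, ← ENNReal.ofReal_mul hD0, hD]
    congr 1
    have h1 : ((k : ℝ) + 1) / 2 + 1 / 2 = (((k + 1 : ℕ) : ℝ) + 1) / 2 := by push_cast; ring
    have hb' : 0 < √b := Real.sqrt_pos.2 hb
    rw [h1]
    field_simp
    rw [pow_succ (1 / (2 * √b)) (k + 1)]
    field_simp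

/-- At frequency zero the outermost exponential equals one, so the last time integral is a Beta
integral with `β = 1`, which raises `Γ((k+1)/2)` to `Γ(1 + (k+1)/2)`. -/
theorem chainKernel_gaussian_zero {b : ℝ} (hb : 0 < b) (k : ℕ) {τ : ℝ} (hτ : 0 < τ) :
    chainKernel (fun v => b * v ^ 2) Set.univ k τ 0 =
      ENNReal.ofReal ((1 / (2 * √b)) ^ k * τ ^ ((k : ℝ) / 2) / Real.Gamma (1 + (k : ℝ) / 2)) := by
  cases k with
  | zero => simp [chainKernel]
  | succ k =>
    have hΓ : 0 < Real.Gamma (((k : ℝ) + 1) / 2) := Real.Gamma_pos_of_pos (by positivity)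
    set D : ℝ := (1 / (2 * √b)) ^ (k + 1) / Real.Gamma ((k + 1) / 2) with hD
    have hD0 : 0 ≤ D := by positivity
    rw [chainKernel]
    calc _ = ∫⁻ σ in Set.Ioc 0 τ, ENNReal.ofReal D *
            ENNReal.ofReal (σ ^ (((k : ℝ) + 1) / 2 - 1) * (τ - σ) ^ ((1 : ℝ) - 1)) := by
          refine setLIntegral_congr_fun measurableSet_Ioc fun σ hσ => ?_
          have := lintegral_chainKernel_gaussian hb k hσ.1
          simp only [Measure.restrict_univ, zero_add, this, hD, sub_self, Real.rpow_zero, mul_one]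
          rw [← ENNReal.ofReal_mul hD0]
          simp [hD]
      _ = _ := by
          rw [lintegral_const_mul _ (by fun_prop),
            lintegral_rpow_mul_sub_rpow (by positivity) (by norm_num) hτ,
            ← ENNReal.ofReal_mul hD0, hD, Real.Gamma_one]
          congr 1
          have h1 : ((k : ℝ) + 1) / 2 + 1 = 1 + ((k + 1 : ℕ) : ℝ) / 2 := by push_cast; ring
          have h2 : 1 + (((k + 1 : ℕ) : ℝ)) / 2 - 1 = ((k + 1 : ℕ) : ℝ) / 2 := by ring
          rw [h1, h2]
          field_simp

theorem lintegral_chainKernel_gaussian_ne_top {b : ℝ} (hb : 0 < b) (k : ℕ) {τ : ℝ} (hτ : 0 < τ) :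
    ∫⁻ x, chainKernel (fun v => b * v ^ 2) Set.univ k τ x ≠ ∞ := by
  intro h
  have := lintegral_chainKernel_gaussian hb k hτ
  rw [h, ENNReal.mul_top (by simp [Real.pi_pos])] at this
  exact ENNReal.ofReal_ne_top this.symm

/-- Convergence of the chain kernels when the exponents converge to a Gaussian exponent and stay
above one on a sufficiently large part of the windows. -/
theorem tendsto_chainKernel {Φ : ℕ → ℝ → ℝ} (hΦm : ∀ n, Measurable (Φ n)) {d : ℕ → ℝ}
    (hd : Tendsto d atTop atTop) {b : ℝ} (hb : 0 < b)
    (hlim : ∀ v, Tendsto (fun n => Φ n v) atTop (𝓝 (b * v ^ 2)))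
    (hlow : ∀ M : ℕ, 1 ≤ M → ∃ c, 0 < c ∧ ∀ n v, |v| ≤ M * d n → c * v ^ 2 ≤ Φ n v)
    (k : ℕ) {τ : ℝ} (hτ : 0 ≤ τ) (v : ℝ) :
    Tendsto (fun n => chainKernel (Φ n) (Set.Ioc (-d n) (d n)) k τ v) atTop
      (𝓝 (chainKernel (fun v => b * v ^ 2) Set.univ k τ v)) := by
  induction k generalizing τ v with
  | zero =>
    simp only [chainKernel]
    refine ENNReal.tendsto_ofReal ((Real.continuous_exp.tendsto _).comp ?_)
    exact ((hlim v).const_mul τ).neg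
  | succ k ih =>
    -- The budget `k + 2` covers the `k` remaining steps, the increment `x`, and the starting
    -- frequency, which lies in the window for large `n`.
    obtain ⟨c, hc, hcle⟩ := hlow (k + 2) (by omega)
    have hcm : Measurable (fun v : ℝ => c * v ^ 2) := by fun_prop
    have hdom : ∀ᶠ n in atTop, ∀ σ, 0 ≤ σ → ∀ x ∈ Set.Ioc (-d n) (d n),
        chainKernel (Φ n) (Set.Ioc (-d n) (d n)) k σ (v + x) ≤
          chainKernel (fun v => c * v ^ 2) Set.univ k σ (v + x) := by
      filter_upwards [hd.eventually_ge_atTop |v|] with n hn σ hσ x hx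
      refine chainKernel_le_chainKernel (d := d n) (M := k + 2) ((abs_nonneg _).trans hn)
        measurableSet_Ioc (fun x hx => abs_le.2 ⟨hx.1.le, hx.2⟩) (hcle n) (by omega) hσ ?_
      have : ((k + 2 - k : ℕ) : ℝ) = 2 := by
        rw [show k + 2 - k = 2 by omega]; norm_num
      rw [this]
      have := abs_add_le v x
      have := abs_le.2 ⟨hx.1.le, hx.2⟩
      linarith
    have hinner : ∀ σ, 0 < σ → Tendsto (fun n => ∫⁻ x in Set.Ioc (-d n) (d n),
        chainKernel (Φ n) (Set.Ioc (-d n) (d n)) k σ (v + x)) atTop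
        (𝓝 (∫⁻ x in Set.univ, chainKernel (fun v => b * v ^ 2) Set.univ k σ (v + x))) := by
      intro σ hσ
      simp_rw [← lintegral_indicator measurableSet_Ioc, Measure.restrict_univ]
      refine tendsto_lintegral_filter_of_dominated_convergence
        (fun x => chainKernel (fun v => c * v ^ 2) Set.univ k σ (v + x)) ?_ ?_ ?_ ?_
      · refine Eventually.of_forall fun n => Measurable.indicator ?_ measurableSet_Ioc
        exact (measurable_chainKernel (hΦm n) _ k).comp
          (g := fun p : ℝ × ℝ => chainKernel (Φ n) (Set.Ioc (-d n) (d n)) k p.1 p.2)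
          (f := fun x : ℝ => (σ, v + x)) (by fun_prop)
      · filter_upwards [hdom] with n hn
        refine ae_of_all _ fun x => ?_
        exact Set.indicator_apply_le' (hn σ hσ.le x) (fun _ => zero_le)
      · rw [lintegral_add_left_eq_self (fun x => chainKernel (fun v => c * v ^ 2) Set.univ k σ x)]
        exact lintegral_chainKernel_gaussian_ne_top hc k hσ
      · refine ae_of_all _ fun x => (ih hσ.le (v + x)).congr' ?_
        filter_upwards [hd.eventually_gt_atTop |x|] with n hn
        rw [Set.indicator_of_mem]
        exact ⟨(abs_lt.1 hn).1, (abs_lt.1 hn).2.le⟩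
    simp only [chainKernel]
    refine tendsto_lintegral_filter_of_dominated_convergence
        (fun σ => ENNReal.ofReal (2 * Real.pi)⁻¹ *
          ∫⁻ x, chainKernel (fun v => c * v ^ 2) Set.univ k σ (v + x)) ?_ ?_ ?_ ?_
    · refine Eventually.of_forall fun n => ?_
      have := (measurable_chainKernel_inner (hΦm n) (Set.Ioc (-d n) (d n)) k).comp
        (f := fun x : ℝ => (x, v)) (by fun_prop)
      simp only [Function.comp_def] at this
      fun_prop
    · filter_upwards [hdom, hd.eventually_ge_atTop |v|] with n hn hnv
      filter_upwards [ae_restrict_mem measurableSet_Ioc] with σ hσ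
      rw [← one_mul (ENNReal.ofReal (2 * Real.pi)⁻¹ *
          ∫⁻ x, chainKernel (fun v => c * v ^ 2) Set.univ k σ (v + x))]
      gcongr ?_ * (_ * ?_)
      · rw [ENNReal.ofReal_le_one, Real.exp_le_one_iff, neg_nonpos]
        refine mul_nonneg (sub_nonneg.2 hσ.2) (le_trans (by positivity) (hcle n v ?_))
        refine hnv.trans (le_mul_of_one_le_left ((abs_nonneg _).trans hnv) ?_)
        exact_mod_cast (by omega)
      · calc _ ≤ ∫⁻ x in Set.Ioc (-d n) (d n),
              chainKernel (fun v => c * v ^ 2) Set.univ k σ (v + x) :=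
              setLIntegral_mono' measurableSet_Ioc fun x hx => hn σ hσ.1.le x hx
          _ ≤ _ := setLIntegral_le_lintegral _ _
    -- Shifting `v` to `0` identifies the integral of the dominating function with the Gaussian
    -- chain of length `k + 1` at frequency zero, which is finite.
    · have h0 : ∀ σ ∈ Set.Ioc 0 τ, ENNReal.ofReal (2 * Real.pi)⁻¹ *
          ∫⁻ x, chainKernel (fun v => c * v ^ 2) Set.univ k σ (v + x) =
          ENNReal.ofReal (Real.exp (-((τ - σ) * (c * 0 ^ 2)))) * (ENNReal.ofReal (2 * Real.pi)⁻¹ *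
          ∫⁻ x in Set.univ, chainKernel (fun v => c * v ^ 2) Set.univ k σ (0 + x)) := by
        intro σ _
        rw [lintegral_add_left_eq_self (fun x => chainKernel (fun v => c * v ^ 2) Set.univ k σ x)]
        simp
      rw [setLIntegral_congr_fun measurableSet_Ioc h0]
      rcases hτ.eq_or_lt with rfl | hτ'
      · simp
      · have := chainKernel_gaussian_zero hc (k + 1) hτ'
        rw [chainKernel] at this
        rw [this]
        exact ENNReal.ofReal_ne_top
    · filter_upwards [ae_restrict_mem measurableSet_Ioc] with σ hσ
      refine ENNReal.Tendsto.mul ?_ (Or.inr ?_) (ENNReal.Tendsto.const_mul (hinner σ hσ.1)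
        (Or.inr ENNReal.ofReal_ne_top)) (Or.inr ENNReal.ofReal_ne_top)
      · refine ENNReal.tendsto_ofReal ((Real.continuous_exp.tendsto _).comp ?_)
        exact ((hlim v).const_mul (τ - σ)).neg
      · rw [Measure.restrict_univ,
          lintegral_add_left_eq_self (fun x => chainKernel (fun v => b * v ^ 2) Set.univ k σ x)]
        exact ENNReal.mul_ne_top ENNReal.ofReal_ne_top
          (lintegral_chainKernel_gaussian_ne_top hb k hσ.1)

/-! ### Right-continuous paths, regularized processes, Markov property. -/

/-- The time is replaced by the next point of the grid of mesh `1 / (n + 1)` strictly to its right.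
Each approximation takes countably many times, and right continuity gives pointwise convergence. -/
theorem measurable_uncurry_of_rightContinuous {Ω : Type*} {m : MeasurableSpace Ω} {W : ℝ → Ω → ℝ}
    (hm : ∀ r, Measurable (W r))
    (hr : ∀ ω s, ContinuousWithinAt (fun r => W r ω) (Set.Ioi s) s) :
    Measurable (fun p : ℝ × Ω => W p.1 p.2) := by
  refine measurable_of_tendsto_metrizable (f := fun (n : ℕ) (p : ℝ × Ω) =>
    W (((⌊((n : ℝ) + 1) * p.1⌋ : ℝ) + 1) / ((n : ℝ) + 1)) p.2) (fun n => ?_) ?_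
  · have h1 : Measurable (fun q : ℤ × Ω => W (((q.1 : ℝ) + 1) / ((n : ℝ) + 1)) q.2) :=
      measurable_from_prod_countable_right fun k => hm (((k : ℝ) + 1) / ((n : ℝ) + 1))
    have h2 : Measurable (fun p : ℝ × Ω => (⌊((n : ℝ) + 1) * p.1⌋, p.2)) := by fun_prop
    exact h1.comp h2
  · rw [tendsto_pi_nhds]
    rintro ⟨s, ω⟩
    refine (hr ω s).tendsto.comp (tendsto_nhdsWithin_iff.2 ⟨?_, Eventually.of_forall fun n => ?_⟩)
    · have h0 : Tendsto (fun n : ℕ => s + 1 / ((n : ℝ) + 1)) atTop (𝓝 s) := by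
        simpa using tendsto_one_div_add_atTop_nhds_zero_nat.const_add s
      refine tendsto_of_tendsto_of_tendsto_of_le_of_le tendsto_const_nhds h0 (fun n => ?_)
        (fun n => ?_)
      · have hn : (0 : ℝ) < (n : ℝ) + 1 := by positivity
        simp only
        rw [le_div_iff₀ hn]
        have := (Int.lt_floor_add_one (((n : ℝ) + 1) * s)).le
        linarith
      · have hn : (0 : ℝ) < (n : ℝ) + 1 := by positivity
        simp only
        rw [div_le_iff₀ hn, add_mul s, one_div_mul_cancel hn.ne']
        have := Int.floor_le (((n : ℝ) + 1) * s)
        linarith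
    · have hn : (0 : ℝ) < (n : ℝ) + 1 := by positivity
      simp only [Set.mem_Ioi]
      rw [lt_div_iff₀ hn]
      have := Int.lt_floor_add_one (((n : ℝ) + 1) * s)
      linarith

/-- The σ-algebra is a free argument so that this also applies to the σ-algebra generated by the
past. -/
theorem measurable_integral_of_rightContinuous {Ω : Type*} {m : MeasurableSpace Ω}
    {W : ℝ → Ω → ℝ} (hm : ∀ r, Measurable (W r))
    (hr : ∀ ω s, ContinuousWithinAt (fun r => W r ω) (Set.Ioi s) s) {g : ℝ → ℝ}
    (hg : Measurable g) (A : Set ℝ) :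
    Measurable (fun ω => ∫ r in A, g (W r ω)) := by
  have h : StronglyMeasurable (fun p : Ω × ℝ => g (W p.2 p.1)) :=
    (hg.comp ((measurable_uncurry_of_rightContinuous hm hr).comp measurable_swap)).stronglyMeasurable
  exact (h.integral_prod_right' (ν := volume.restrict A)).measurable

/-- A regularized Lévy process with exponent `Ψ`, in real time: every path is right continuous,
the increments are independent of the past, and the characteristic functions are given by `Ψ`. -/
structure IsRegularLevy {Ω : Type*} [MeasurableSpace Ω] (Z : ℝ → Ω → ℝ) (P : Measure Ω)
    (Ψ : ℝ → ℝ) : Prop where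
  measurable : ∀ s, Measurable (Z s)
  rightContinuous : ∀ ω s, ContinuousWithinAt (fun r => Z r ω) (Set.Ioi s) s
  indep : ∀ s τ, 0 ≤ s → s ≤ τ →
    IndepFun (fun ω (r : Set.Iic s) => Z r ω) (fun ω => Z τ ω - Z s ω) P
  charFun_sub : ∀ s τ u, 0 ≤ s → s ≤ τ →
    ∫ ω, Complex.exp (Complex.I * (u * (Z τ ω - Z s ω) : ℝ)) ∂P =
      (Real.exp (-((τ - s) * Ψ u)) : ℂ)
  charFun : ∀ s u, 0 ≤ s →
    ∫ ω, Complex.exp (Complex.I * (u * Z s ω : ℝ)) ∂P = (Real.exp (-(s * Ψ u)) : ℂ)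

namespace IsRegularLevy

variable {Ω : Type*} [mΩ : MeasurableSpace Ω] {P : Measure Ω} {Z : ℝ → Ω → ℝ} {Ψ : ℝ → ℝ}

theorem measurable_uncurry (h : IsRegularLevy Z P Ψ) :
    Measurable (fun p : ℝ × Ω => Z p.1 p.2) :=
  measurable_uncurry_of_rightContinuous h.measurable h.rightContinuous

omit mΩ in
theorem measurable_eval_comap_Iic (Z : ℝ → Ω → ℝ) {r s : ℝ} (hrs : r ≤ s) :
    Measurable[MeasurableSpace.comap (fun ω (r : Set.Iic s) => Z r ω) inferInstance] (Z r) :=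
  (measurable_pi_apply (⟨r, hrs⟩ : Set.Iic s)).comp
    (comap_measurable (fun ω (r : Set.Iic s) => Z r ω))

/-- Markov property: an exponential of an increment decouples from the past. -/
theorem integral_exp_sub_mul (h : IsRegularLevy Z P Ψ) {s τ : ℝ} (hs : 0 ≤ s) (hsτ : s ≤ τ)
    (u : ℝ) {V : Ω → ℂ} (hV : Measurable[MeasurableSpace.comap
      (fun ω (r : Set.Iic s) => Z r ω) inferInstance] V) :
    ∫ ω, Complex.exp (Complex.I * (u * (Z τ ω - Z s ω) : ℝ)) * V ω ∂P =
      (Real.exp (-((τ - s) * Ψ u)) : ℂ) * ∫ ω, V ω ∂P := by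
  have hle : MeasurableSpace.comap (fun ω (r : Set.Iic s) => Z r ω) inferInstance ≤ mΩ :=
    (measurable_pi_lambda _ fun r => h.measurable _).comap_le
  have hind : IndepFun V (fun ω => Z τ ω - Z s ω) P := by
    have := h.indep s τ hs hsτ
    rw [IndepFun_iff_Indep] at this ⊢
    exact indep_of_indep_of_le_left this hV.comap_le
  have hexp : Measurable (fun x : ℝ => Complex.exp (Complex.I * (u * x : ℝ))) := by fun_prop
  have hind2 : IndepFun (fun ω => Complex.exp (Complex.I * (u * (Z τ ω - Z s ω) : ℝ))) V P :=
    hind.symm.comp hexp measurable_id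
  rw [hind2.integral_fun_mul_eq_mul_integral
    (hexp.comp ((h.measurable τ).sub (h.measurable s))).aestronglyMeasurable
    (hV.mono hle le_rfl).aestronglyMeasurable, h.charFun_sub s τ u hs hsτ]

end IsRegularLevy

/-! ### Occupation functional of the sinc kernel and its moments. -/

/-- The inverse Fourier transform of the indicator of `[-δ, δ]`. -/
noncomputable def sincKernel (δ y : ℝ) : ℝ :=
  (2 * Real.pi)⁻¹ * ∫ x in -δ..δ, Real.cos (x * y)

theorem continuous_sincKernel (δ : ℝ) : Continuous (sincKernel δ) := by
  unfold sincKernel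
  refine continuous_const.mul ?_
  exact intervalIntegral.continuous_parametric_intervalIntegral_of_continuous'
    (f := fun y x => Real.cos (x * y)) (by unfold Function.uncurry; fun_prop) _ _

theorem abs_sincKernel_le (δ y : ℝ) : |sincKernel δ y| ≤ (2 * Real.pi)⁻¹ * |δ - -δ| := by
  rw [sincKernel, abs_mul, abs_of_pos (by positivity : (0 : ℝ) < (2 * Real.pi)⁻¹)]
  refine mul_le_mul_of_nonneg_left ?_ (by positivity)
  have := intervalIntegral.norm_integral_le_of_norm_le_const (a := -δ) (b := δ) (C := 1)
    (f := fun x => Real.cos (x * y)) fun x _ => by simpa using Real.abs_cos_le_one _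
  rwa [one_mul] at this

/-- The sine part is odd and cancels on the symmetric window. The exponential form is the one that
combines with characteristic functions. -/
theorem ofReal_sincKernel (δ y : ℝ) :
    (sincKernel δ y : ℂ) =
      ((2 * Real.pi)⁻¹ : ℝ) * ∫ x in -δ..δ, Complex.exp (Complex.I * (x * y : ℝ)) := by
  have h1 : ∀ x : ℝ, Complex.exp (Complex.I * (x * y : ℝ)) =
      (Real.cos (x * y) : ℂ) + (Real.sin (x * y) : ℂ) * Complex.I := by
    intro x
    rw [mul_comm, Complex.exp_mul_I, Complex.ofReal_cos, Complex.ofReal_sin]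
  have h2 : ∫ x in -δ..δ, Real.sin (x * y) = 0 := by
    have := intervalIntegral.integral_comp_neg (a := -δ) (b := δ) (fun x => Real.sin (x * y))
    simp only [neg_mul, Real.sin_neg, intervalIntegral.integral_neg, neg_neg] at this
    linarith
  rw [sincKernel]
  simp_rw [h1]
  rw [intervalIntegral.integral_add (Continuous.intervalIntegrable (by fun_prop) _ _)
    (Continuous.intervalIntegrable (by fun_prop) _ _), intervalIntegral.integral_mul_const,
    intervalIntegral.integral_ofReal, intervalIntegral.integral_ofReal, h2]
  push_cast
  ring

/-- The additive functional of `g` along `Z`. -/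
noncomputable def occupation {Ω : Type*} (Z : ℝ → Ω → ℝ) (g : ℝ → ℝ) (τ : ℝ) (ω : Ω) : ℝ :=
  ∫ r in (0 : ℝ)..τ, g (Z r ω)

theorem integrable_prod_restrict_of_bound {Ω : Type*} [MeasurableSpace Ω] {P : Measure Ω}
    [IsFiniteMeasure P] {A : Set ℝ} (hA : MeasurableSet A) (hA' : volume A ≠ ∞) {C : ℝ}
    {F : Ω × ℝ → ℂ} (hF : Measurable F) (hb : ∀ ω, ∀ s ∈ A, ‖F (ω, s)‖ ≤ C) :
    Integrable F (P.prod (volume.restrict A)) := by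
  have : IsFiniteMeasure (volume.restrict A) := ⟨by simpa using hA'.lt_top⟩
  refine Integrable.of_bound hF.aestronglyMeasurable C ?_
  rw [← Measure.restrict_univ (μ := P), Measure.prod_restrict]
  filter_upwards [ae_restrict_mem (MeasurableSet.univ.prod hA)] with p hp
  exact hb p.1 p.2 hp.2

namespace IsRegularLevy

variable {Ω : Type*} [mΩ : MeasurableSpace Ω] {P : Measure Ω} {Z : ℝ → Ω → ℝ} {Ψ : ℝ → ℝ}
  {g : ℝ → ℝ}

theorem intervalIntegrable_comp (h : IsRegularLevy Z P Ψ) (hg : Measurable g) {B : ℝ}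
    (hB : ∀ y, |g y| ≤ B) (ω : Ω) (a b : ℝ) :
    IntervalIntegrable (fun r => g (Z r ω)) volume a b := by
  have hm : Measurable (fun r => g (Z r ω)) :=
    hg.comp (h.measurable_uncurry.comp (measurable_id.prodMk measurable_const))
  refine IntervalIntegrable.mono_fun (f := fun _ => B) intervalIntegrable_const
    hm.aestronglyMeasurable (ae_of_all _ fun r => ?_)
  simpa using (hB _).trans (le_abs_self B)

theorem continuous_occupation (h : IsRegularLevy Z P Ψ) (hg : Measurable g) {B : ℝ}
    (hB : ∀ y, |g y| ≤ B) (ω : Ω) : Continuous (fun τ => occupation Z g τ ω) :=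
  intervalIntegral.continuous_primitive (fun a b => h.intervalIntegrable_comp hg hB ω a b) 0

omit mΩ in
theorem abs_occupation_le {B : ℝ} (hB : ∀ y, |g y| ≤ B) {τ : ℝ} (hτ : 0 ≤ τ) (ω : Ω) :
    |occupation Z g τ ω| ≤ B * τ := by
  have := intervalIntegral.norm_integral_le_of_norm_le_const (a := 0) (b := τ) (C := B)
    (f := fun r => g (Z r ω)) fun x _ => hB _
  rwa [sub_zero, abs_of_nonneg hτ] at this

/-- The path frozen after time `s` is measurable with respect to the past of `s`, remains right
continuous, and agrees with the original on `(0, s]`. -/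
theorem measurable_occupation_past (h : IsRegularLevy Z P Ψ) (hg : Measurable g) {s : ℝ}
    (hs : 0 ≤ s) : Measurable[MeasurableSpace.comap
      (fun ω (r : Set.Iic s) => Z r ω) inferInstance] (occupation Z g s) := by
  have h1 := @measurable_integral_of_rightContinuous Ω (MeasurableSpace.comap
      (fun ω (r : Set.Iic s) => Z r ω) inferInstance) (fun r ω => Z (min r s) ω) ?_ ?_ g hg
      (Set.Ioc 0 s)
  · convert h1 using 2 with ω
    rw [occupation, intervalIntegral.integral_of_le hs]
    refine setIntegral_congr_fun measurableSet_Ioc fun r hr => ?_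
    simp only [min_eq_left hr.2]
  · intro r
    exact measurable_eval_comap_Iic Z (min_le_right r s)
  · intro ω r
    rcases lt_or_ge r s with hr | hr
    · refine ((h.rightContinuous ω r).congr_of_eventuallyEq ?_ ?_)
      · filter_upwards [nhdsWithin_le_nhds (Iio_mem_nhds hr)] with x hx
        rw [min_eq_left (le_of_lt hx)]
      · rw [min_eq_left hr.le]
    · refine (continuousWithinAt_const (b := Z s ω)).congr_of_eventuallyEq ?_ ?_
      · filter_upwards [self_mem_nhdsWithin] with x hx
        rw [min_eq_right (hr.trans (le_of_lt hx))]
      · rw [min_eq_right hr]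

theorem measurable_occupation (h : IsRegularLevy Z P Ψ) (hg : Measurable g) {s : ℝ}
    (hs : 0 ≤ s) : Measurable (occupation Z g s) :=
  (h.measurable_occupation_past hg hs).mono
    (measurable_pi_lambda _ fun _ => h.measurable _).comap_le le_rfl

theorem measurable_occupation_max (h : IsRegularLevy Z P Ψ) (hg : Measurable g) {B : ℝ}
    (hB : ∀ y, |g y| ≤ B) : Measurable (fun p : ℝ × Ω => occupation Z g (max p.1 0) p.2) :=
  measurable_uncurry_of_rightContinuous (W := fun s ω => occupation Z g (max s 0) ω)
    (fun _ => h.measurable_occupation hg (le_max_right _ _)) fun ω _ =>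
    ((h.continuous_occupation hg hB ω).comp (by fun_prop :
      Continuous fun s : ℝ => max s 0)).continuousWithinAt

/-- This singles out the last of `k + 1` ordered times. The integrand is only right continuous in
time, so the fundamental theorem is used with right derivatives. -/
theorem occupation_pow_succ (h : IsRegularLevy Z P Ψ) (hg : Continuous g) {B : ℝ}
    (hB : ∀ y, |g y| ≤ B) (k : ℕ) (τ : ℝ) (ω : Ω) :
    occupation Z g τ ω ^ (k + 1) =
      ((k : ℝ) + 1) * ∫ s in (0 : ℝ)..τ, g (Z s ω) * occupation Z g s ω ^ k := by
  have hc := h.continuous_occupation hg.measurable hB ω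
  have hint := h.intervalIntegrable_comp hg.measurable hB ω 0 τ
  have := intervalIntegral.integral_eq_sub_of_hasDeriv_right (a := 0) (b := τ)
    (f := fun s => occupation Z g s ω ^ (k + 1))
    (f' := fun s => ((k : ℝ) + 1) * (g (Z s ω) * occupation Z g s ω ^ k))
    (hc.pow _).continuousOn (fun x _ => ?_) ?_
  · rw [intervalIntegral.integral_const_mul] at this
    rw [this]
    simp [occupation]
  · have hd : HasDerivWithinAt (fun s => occupation Z g s ω) (g (Z x ω)) (Set.Ioi x) x := by
      refine (intervalIntegral.integral_hasDerivWithinAt_right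
        (h.intervalIntegrable_comp hg.measurable hB ω 0 x) (s := Set.Ici x) (t := Set.Ioi x)
        ?_ ?_).mono Set.Ioi_subset_Ici_self
      · refine ⟨Set.univ, univ_mem, Measurable.aestronglyMeasurable ?_⟩
        exact hg.measurable.comp (h.measurable_uncurry.comp (measurable_id.prodMk measurable_const))
      · exact hg.continuousAt.comp_continuousWithinAt (h.rightContinuous ω x)
    have := hd.fun_pow (k + 1)
    simp only [Nat.add_sub_cancel] at this
    refine this.congr_deriv ?_
    push_cast
    ring
  · exact (hint.mul_continuousOn (hc.pow k).continuousOn).const_mul _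

theorem exp_mul_occupation_pow_succ (h : IsRegularLevy Z P Ψ) (hg : Continuous g) {B : ℝ}
    (hB : ∀ y, |g y| ≤ B) (k : ℕ) {τ : ℝ} (hτ : 0 ≤ τ) (u : ℝ) (ω : Ω) :
    Complex.exp (Complex.I * (u * Z τ ω : ℝ)) * (occupation Z g τ ω : ℂ) ^ (k + 1) =
      ((k : ℂ) + 1) * ∫ s in Set.Ioc 0 τ,
        Complex.exp (Complex.I * (u * (Z τ ω - Z s ω) : ℝ)) *
          (Complex.exp (Complex.I * (u * Z s ω : ℝ)) *
            ((g (Z s ω) : ℂ) * (occupation Z g s ω : ℂ) ^ k)) := by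
  have e1 : (occupation Z g τ ω : ℂ) ^ (k + 1) = ((k : ℂ) + 1) *
      ∫ s in Set.Ioc 0 τ, ((g (Z s ω) * occupation Z g s ω ^ k : ℝ) : ℂ) := by
    rw [integral_complex_ofReal, ← intervalIntegral.integral_of_le hτ, ← Complex.ofReal_pow,
      h.occupation_pow_succ hg hB, Complex.ofReal_mul]
    congr 1
    simp
  rw [e1, mul_left_comm, ← integral_const_mul]
  congr 1
  refine setIntegral_congr_fun measurableSet_Ioc fun s _ => ?_
  -- Splitting the phase at time `s` isolates an increment independent of everything else in the
  -- integrand.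
  have e : Complex.exp (Complex.I * (u * Z τ ω : ℝ)) =
      Complex.exp (Complex.I * (u * (Z τ ω - Z s ω) : ℝ)) *
        Complex.exp (Complex.I * (u * Z s ω : ℝ)) := by
    rw [← Complex.exp_add, ← mul_add, ← Complex.ofReal_add, ← mul_add, sub_add_cancel]
  rw [e, mul_assoc, Complex.ofReal_mul (g _), Complex.ofReal_pow]

theorem integrable_exp_sub_mul_occupation_pow [IsFiniteMeasure P] (h : IsRegularLevy Z P Ψ)
    (hg : Continuous g) {B : ℝ} (hB : ∀ y, |g y| ≤ B) (k : ℕ) (τ : ℝ) (u : ℝ) :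
    Integrable (fun p : Ω × ℝ => Complex.exp (Complex.I * (u * (Z τ p.1 - Z p.2 p.1) : ℝ)) *
        (Complex.exp (Complex.I * (u * Z p.2 p.1 : ℝ)) *
          ((g (Z p.2 p.1) : ℂ) * (occupation Z g (max p.2 0) p.1 : ℂ) ^ k)))
      (P.prod (volume.restrict (Set.Ioc 0 τ))) := by
  have hB0 : 0 ≤ B := (abs_nonneg _).trans (hB 0)
  refine integrable_prod_restrict_of_bound (C := B * (B * τ) ^ k) measurableSet_Ioc (by simp)
    ?_ fun ω s hs => ?_
  · have h1 : Measurable (fun p : Ω × ℝ => Z p.2 p.1) := h.measurable_uncurry.comp measurable_swap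
    have h2 : Measurable (fun p : Ω × ℝ => Z τ p.1) := (h.measurable τ).comp measurable_fst
    have h3 : Measurable (fun p : Ω × ℝ => occupation Z g (max p.2 0) p.1) :=
      (h.measurable_occupation_max hg.measurable hB).comp measurable_swap
    have hgm := hg.measurable
    have hfun : Measurable (fun q : ℝ × ℝ × ℝ =>
        Complex.exp (Complex.I * (u * (q.1 - q.2.1) : ℝ)) *
        (Complex.exp (Complex.I * (u * q.2.1 : ℝ)) * ((g q.2.1 : ℂ) * (q.2.2 : ℂ) ^ k))) := by
      fun_prop
    have hc := hfun.comp (h2.prodMk (h1.prodMk h3))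
    exact hc
  · simp only [norm_mul, norm_pow, mul_comm Complex.I, Complex.norm_exp_ofReal_mul_I, one_mul,
      Complex.norm_real, Real.norm_eq_abs]
    gcongr
    · exact hB _
    · rw [max_eq_left hs.1.le]
      exact (abs_occupation_le hB hs.1.le ω).trans (by gcongr; exact hs.2)

/-- Fubini and the Markov property at the last time `s` produce the outer exponential in the
recursion of `chainKernel`. -/
theorem integral_exp_mul_occupation_pow_succ [IsProbabilityMeasure P] (h : IsRegularLevy Z P Ψ)
    (hg : Continuous g) {B : ℝ} (hB : ∀ y, |g y| ≤ B) (k : ℕ) {τ : ℝ} (hτ : 0 ≤ τ) (u : ℝ) :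
    ∫ ω, Complex.exp (Complex.I * (u * Z τ ω : ℝ)) * (occupation Z g τ ω : ℂ) ^ (k + 1) ∂P =
      ((k : ℂ) + 1) * ∫ s in Set.Ioc 0 τ, (Real.exp (-((τ - s) * Ψ u)) : ℂ) *
        ∫ ω, Complex.exp (Complex.I * (u * Z s ω : ℝ)) *
          ((g (Z s ω) : ℂ) * (occupation Z g s ω : ℂ) ^ k) ∂P := by
  simp_rw [h.exp_mul_occupation_pow_succ hg hB k hτ u]
  -- Joint measurability of the occupation functional is available with time clamped at zero, which
  -- changes nothing on `(0, τ]`.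
  have hmax : ∀ ω, ∫ s in Set.Ioc 0 τ, Complex.exp (Complex.I * (u * (Z τ ω - Z s ω) : ℝ)) *
          (Complex.exp (Complex.I * (u * Z s ω : ℝ)) *
            ((g (Z s ω) : ℂ) * (occupation Z g s ω : ℂ) ^ k)) =
      ∫ s in Set.Ioc 0 τ, Complex.exp (Complex.I * (u * (Z τ ω - Z s ω) : ℝ)) *
          (Complex.exp (Complex.I * (u * Z s ω : ℝ)) *
            ((g (Z s ω) : ℂ) * (occupation Z g (max s 0) ω : ℂ) ^ k)) := fun ω =>
    setIntegral_congr_fun measurableSet_Ioc fun s hs => by simp only [max_eq_left hs.1.le]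
  simp_rw [hmax]
  rw [integral_const_mul, integral_integral_swap
    (h.integrable_exp_sub_mul_occupation_pow hg hB k τ u)]
  congr 1
  refine setIntegral_congr_fun measurableSet_Ioc fun s hs => ?_
  simp only [max_eq_left hs.1.le]
  refine h.integral_exp_sub_mul hs.1.le hs.2 u ?_
  have hZ : Measurable[MeasurableSpace.comap
      (fun ω (r : Set.Iic s) => Z r ω) inferInstance] (Z s) :=
    measurable_eval_comap_Iic Z le_rfl
  have hO := h.measurable_occupation_past hg.measurable hs.1.le
  have hgm := hg.measurable
  have hfun : Measurable (fun q : ℝ × ℝ => Complex.exp (Complex.I * (u * q.1 : ℝ)) *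
      ((g q.1 : ℂ) * (q.2 : ℂ) ^ k)) := by
    fun_prop
  have hc := hfun.comp (hZ.prodMk hO)
  exact hc

/-- The kernel is an integral of phases `exp (i x y)` over the window, and each phase shifts the
frequency from `u` to `u + x`. This is the inner integral in the recursion of `chainKernel`. -/
theorem integral_exp_mul_sincKernel_mul [IsProbabilityMeasure P] (h : IsRegularLevy Z P Ψ)
    {δ : ℝ} (hδ : 0 ≤ δ) {s : ℝ} (u : ℝ) {V : Ω → ℂ} (hV : Measurable V) {C : ℝ}
    (hC : ∀ ω, ‖V ω‖ ≤ C) :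
    ∫ ω, Complex.exp (Complex.I * (u * Z s ω : ℝ)) * ((sincKernel δ (Z s ω) : ℂ) * V ω) ∂P =
      ((2 * Real.pi)⁻¹ : ℝ) * ∫ x in Set.Ioc (-δ) δ,
        ∫ ω, Complex.exp (Complex.I * ((u + x) * Z s ω : ℝ)) * V ω ∂P := by
  set F : Ω × ℝ → ℂ := fun p => Complex.exp (Complex.I * ((u + p.2) * Z s p.1 : ℝ)) * V p.1 with hF
  have hFm : Measurable F := by
    have h2 : Measurable (fun p : Ω × ℝ => Z s p.1) := (h.measurable s).comp measurable_fst
    have hfun : Measurable (fun q : ℝ × ℝ × ℂ =>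
        Complex.exp (Complex.I * ((u + q.1) * q.2.1 : ℝ)) * q.2.2) := by
      fun_prop
    have hc := hfun.comp (measurable_snd.prodMk (h2.prodMk (hV.comp measurable_fst)))
    exact hc
  have hFi : Integrable F (P.prod (volume.restrict (Set.Ioc (-δ) δ))) := by
    refine integrable_prod_restrict_of_bound (C := C) measurableSet_Ioc (by simp)
      hFm fun ω s hs => ?_
    simp only [hF, norm_mul, mul_comm Complex.I, Complex.norm_exp_ofReal_mul_I, one_mul]
    exact hC ω
  rw [← integral_integral_swap (f := fun ω s => F (ω, s)) hFi, ← integral_const_mul]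
  refine integral_congr_ae (ae_of_all _ fun ω => ?_)
  simp only [hF]
  rw [ofReal_sincKernel, intervalIntegral.integral_of_le (by linarith), integral_mul_const,
    mul_assoc, mul_left_comm, ← mul_assoc (Complex.exp _), ← integral_const_mul]
  congr 2
  refine integral_congr_ae (ae_of_all _ fun x => ?_)
  simp only
  rw [← Complex.exp_add]
  congr 1
  push_cast
  ring

/-- The moments of the additive functional of the kernel `sincKernel δ`. -/
theorem integral_exp_mul_occupation_pow [IsProbabilityMeasure P] (h : IsRegularLevy Z P Ψ)
    (hΨ : Measurable Ψ) (hΨ0 : ∀ x, 0 ≤ Ψ x) {δ : ℝ} (hδ : 0 ≤ δ) (k : ℕ) {τ : ℝ} (hτ : 0 ≤ τ)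
    (u : ℝ) :
    ∫ ω, Complex.exp (Complex.I * (u * Z τ ω : ℝ)) *
        (occupation Z (sincKernel δ) τ ω : ℂ) ^ k ∂P =
      (((k.factorial : ℝ) * (chainKernel Ψ (Set.Ioc (-δ) δ) k τ u).toReal : ℝ) : ℂ) := by
  have hg := continuous_sincKernel δ
  have hB := abs_sincKernel_le δ
  induction k generalizing τ u with
  | zero =>
    have := h.charFun τ u hτ
    simpa [chainKernel, Real.exp_nonneg] using this
  | succ k ih =>
    have hne : volume (Set.Ioc (-δ) δ) ≠ ∞ := by simp
    obtain ⟨C, hC, hCle⟩ := exists_chainKernel_le hΨ0 hne τ k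
    rw [h.integral_exp_mul_occupation_pow_succ hg hB k hτ u]
    have hstep : ∀ s ∈ Set.Ioc 0 τ, (Real.exp (-((τ - s) * Ψ u)) : ℂ) *
        ∫ ω, Complex.exp (Complex.I * (u * Z s ω : ℝ)) *
          ((sincKernel δ (Z s ω) : ℂ) * (occupation Z (sincKernel δ) s ω : ℂ) ^ k) ∂P =
        (((k.factorial : ℝ) * (ENNReal.ofReal (Real.exp (-((τ - s) * Ψ u))) *
          (ENNReal.ofReal (2 * Real.pi)⁻¹ * ∫⁻ x in Set.Ioc (-δ) δ,
            chainKernel Ψ (Set.Ioc (-δ) δ) k s (u + x))).toReal : ℝ) : ℂ) := by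
      intro s hs
      have hOm := h.measurable_occupation hg.measurable hs.1.le
      rw [h.integral_exp_mul_sincKernel_mul hδ u (V := fun ω =>
        (occupation Z (sincKernel δ) s ω : ℂ) ^ k)
        (C := ((2 * Real.pi)⁻¹ * |δ - -δ| * s) ^ k) (by fun_prop) ?_]
      · simp_rw [ih hs.1.le]
        have hm : Measurable (fun x => chainKernel Ψ (Set.Ioc (-δ) δ) k s (u + x)) :=
          (measurable_chainKernel hΨ (Set.Ioc (-δ) δ) k).comp
            (f := fun x : ℝ => (s, u + x)) (by fun_prop)
        rw [integral_complex_ofReal, integral_const_mul, integral_toReal hm.aemeasurable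
          (ae_of_all _ fun x => (hCle s hs.1.le hs.2 _).trans_lt hC.lt_top), ENNReal.toReal_mul,
          ENNReal.toReal_mul, ENNReal.toReal_ofReal (Real.exp_pos _).le,
          ENNReal.toReal_ofReal (by positivity)]
        push_cast
        ring
      · intro ω
        rw [norm_pow, Complex.norm_real, Real.norm_eq_abs]
        gcongr
        exact abs_occupation_le hB hs.1.le ω
    rw [setIntegral_congr_fun measurableSet_Ioc hstep, integral_complex_ofReal,
      integral_const_mul, integral_toReal, chainKernel, Nat.factorial_succ]
    · push_cast
      ring
    · have := (measurable_chainKernel_inner hΨ (Set.Ioc (-δ) δ) k).comp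
        (f := fun x : ℝ => (x, u)) (by fun_prop)
      simp only [Function.comp_def] at this
      fun_prop
    · filter_upwards [ae_restrict_mem measurableSet_Ioc] with s hs
      refine ENNReal.mul_lt_top ENNReal.ofReal_lt_top
        (ENNReal.mul_lt_top ENNReal.ofReal_lt_top ?_)
      calc _ ≤ ∫⁻ x in Set.Ioc (-δ) δ, C :=
            setLIntegral_mono measurable_const fun x _ => hCle s hs.1.le hs.2 _
        _ < ∞ := by
            rw [setLIntegral_const]
            exact ENNReal.mul_lt_top hC.lt_top hne.lt_top

theorem integral_occupation_pow [IsProbabilityMeasure P] (h : IsRegularLevy Z P Ψ)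
    (hΨ : Measurable Ψ) (hΨ0 : ∀ x, 0 ≤ Ψ x) {δ : ℝ} (hδ : 0 ≤ δ) (k : ℕ) {τ : ℝ} (hτ : 0 ≤ τ) :
    ∫ ω, occupation Z (sincKernel δ) τ ω ^ k ∂P =
      (k.factorial : ℝ) * (chainKernel Ψ (Set.Ioc (-δ) δ) k τ 0).toReal := by
  have := h.integral_exp_mul_occupation_pow hΨ hΨ0 hδ k hτ 0
  simp only [zero_mul, Complex.ofReal_zero, mul_zero, Complex.exp_zero, one_mul,
    ← Complex.ofReal_pow] at this
  rw [integral_complex_ofReal] at this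
  exact_mod_cast this

end IsRegularLevy

/-! ### Diffusive rescaling. -/

theorem sincKernel_mul_div {a : ℝ} (ha : 0 < a) (δ y : ℝ) :
    sincKernel (a * δ) (y / a) = a * sincKernel δ y := by
  have h := intervalIntegral.integral_comp_mul_left (a := -δ) (b := δ)
    (fun x => Real.cos (x * (y / a))) ha.ne'
  have h2 : ∀ x : ℝ, a * x * (y / a) = x * y := fun x => by field_simp
  simp only [h2] at h
  rw [sincKernel, sincKernel, h, mul_neg, smul_eq_mul, mul_left_comm a,
    mul_inv_cancel_left₀ ha.ne']

namespace IsRegularLevy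

variable {Ω : Type*} [mΩ : MeasurableSpace Ω] {P : Measure Ω} {Z : ℝ → Ω → ℝ} {Ψ : ℝ → ℝ}

/-- Diffusive rescaling of a regularized Lévy process. -/
theorem rescale (h : IsRegularLevy Z P Ψ) {a : ℝ} (ha : 0 < a) :
    IsRegularLevy (fun r ω => Z (a ^ 2 * r) ω / a) P (fun v => a ^ 2 * Ψ (v / a)) where
  measurable s := (h.measurable _).div_const _
  rightContinuous ω s := by
    refine ContinuousWithinAt.div_const ?_ _
    refine (h.rightContinuous ω (a ^ 2 * s)).comp (t := Set.Ioi (a ^ 2 * s))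
      (f := fun r => a ^ 2 * r) (by fun_prop) fun r hr => ?_
    have ha2 : 0 < a ^ 2 := by positivity
    exact mul_lt_mul_of_pos_left (Set.mem_Ioi.1 hr) ha2
  indep s τ hs hsτ := by
    have h1 := h.indep (a ^ 2 * s) (a ^ 2 * τ) (by positivity) (by gcongr)
    have ha2 : 0 ≤ a ^ 2 := by positivity
    have h2 := h1.comp (φ := fun (x : Set.Iic (a ^ 2 * s) → ℝ) (r : Set.Iic s) =>
        x ⟨a ^ 2 * r, mul_le_mul_of_nonneg_left r.2 ha2⟩ / a)
      (ψ := fun y : ℝ => y / a) (by fun_prop) (by fun_prop)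
    have e : (fun ω => Z (a ^ 2 * τ) ω / a - Z (a ^ 2 * s) ω / a) =
        (fun y : ℝ => y / a) ∘ fun ω => Z (a ^ 2 * τ) ω - Z (a ^ 2 * s) ω :=
      funext fun ω => (sub_div _ _ _).symm
    rw [e]
    exact h2
  charFun_sub s τ u hs hsτ := by
    have h1 := h.charFun_sub (a ^ 2 * s) (a ^ 2 * τ) (u / a) (by positivity) (by gcongr)
    have e : ∀ ω, u * (Z (a ^ 2 * τ) ω / a - Z (a ^ 2 * s) ω / a) =
        u / a * (Z (a ^ 2 * τ) ω - Z (a ^ 2 * s) ω) := fun ω => by ring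
    simp only [e, h1]
    congr 3
    ring
  charFun s u hs := by
    have h1 := h.charFun (a ^ 2 * s) (u / a) (by positivity)
    have e : ∀ ω, u * (Z (a ^ 2 * s) ω / a) = u / a * Z (a ^ 2 * s) ω := fun ω => by ring
    simp only [e, h1]
    congr 3
    ring

end IsRegularLevy

/-- The time change contributes `a⁻²` and the kernel `a`, leaving exactly the normalization `a⁻¹`;
the price is a window enlarged to `a δ`. -/
theorem occupation_rescale {Ω : Type*} (Z : ℝ → Ω → ℝ) {a : ℝ} (ha : 0 < a) (δ τ : ℝ) (ω : Ω) :
    occupation (fun r ω => Z (a ^ 2 * r) ω / a) (sincKernel (a * δ)) τ ω =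
      a⁻¹ * occupation Z (sincKernel δ) (a ^ 2 * τ) ω := by
  simp only [occupation, sincKernel_mul_div ha]
  rw [intervalIntegral.integral_const_mul, intervalIntegral.integral_comp_mul_left
    (fun r => sincKernel δ (Z r ω)) (by positivity), mul_zero, smul_eq_mul]
  field_simp

/-! ### Second moments and vanishing in L². -/

/-- The Laplace transform of Lebesgue measure on `(0, T]`. -/
noncomputable def truncLaplace (T q : ℝ) : ℝ≥0∞ :=
  ∫⁻ s in Set.Ioc 0 T, ENNReal.ofReal (Real.exp (-(s * q)))

/-- The Laplace transform of Lebesgue measure on `(0, ∞)`. -/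
noncomputable def fullLaplace (q : ℝ) : ℝ≥0∞ :=
  ∫⁻ s in Set.Ioi 0, ENNReal.ofReal (Real.exp (-(s * q)))

theorem measurable_truncLaplace (T : ℝ) : Measurable (truncLaplace T) := by
  have : Measurable (fun p : ℝ × ℝ => ENNReal.ofReal (Real.exp (-(p.2 * p.1)))) := by fun_prop
  exact this.lintegral_prod_right'

theorem measurable_fullLaplace : Measurable fullLaplace := by
  have : Measurable (fun p : ℝ × ℝ => ENNReal.ofReal (Real.exp (-(p.2 * p.1)))) := by fun_prop
  exact this.lintegral_prod_right'

theorem fullLaplace_eq {q : ℝ} (hq : 0 < q) : fullLaplace q = ENNReal.ofReal (1 / q) := by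
  have hi : IntegrableOn (fun s : ℝ => Real.exp (-(s * q))) (Set.Ioi 0) := by
    simpa [mul_comm] using exp_neg_integrableOn_Ioi 0 hq
  rw [fullLaplace, ← ofReal_integral_eq_lintegral_ofReal hi (ae_of_all _ fun s => (Real.exp_pos _).le)]
  congr 1
  have := integral_exp_mul_Ioi (neg_lt_zero.2 hq) 0
  simpa [mul_comm] using this

theorem truncLaplace_le {T q : ℝ} (hq : 0 < q) :
    truncLaplace T q ≤ ENNReal.ofReal (min T (1 / q)) := by
  rw [ENNReal.ofReal_min]
  refine le_min ?_ ?_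
  · calc truncLaplace T q ≤ ∫⁻ s in Set.Ioc 0 T, 1 := by
          refine setLIntegral_mono measurable_const fun s hs => ?_
          rw [ENNReal.ofReal_le_one, Real.exp_le_one_iff, neg_nonpos]
          exact mul_nonneg hs.1.le hq.le
      _ = ENNReal.ofReal T := by simp
  · rw [← fullLaplace_eq hq]
    exact lintegral_mono' (Measure.restrict_mono Set.Ioc_subset_Ioi_self le_rfl) le_rfl

theorem lintegral_exp_sub_le (s q : ℝ) :
    ∫⁻ r in Set.Ici s, ENNReal.ofReal (Real.exp (-((r - s) * q))) ≤ fullLaplace q := by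
  rw [fullLaplace, setLIntegral_congr Ioi_ae_eq_Ici, ← lintegral_indicator measurableSet_Ici,
    ← lintegral_indicator measurableSet_Ici,
    ← lintegral_sub_right_eq_self ((Set.Ici 0).indicator _) s]
  refine le_of_eq (lintegral_congr fun r => ?_)
  simp [Set.indicator_apply]

/-- The bound for the joint characteristic function of the process at two times. -/
noncomputable def twoTimeKernel (Ψ : ℝ → ℝ) (p q : ℝ × ℝ) : ℝ≥0∞ :=
  (Set.Ici p.1).indicator (fun r => ENNReal.ofReal (Real.exp (-(p.1 * Ψ (p.2 - q.2)))) *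
    ENNReal.ofReal (Real.exp (-((r - p.1) * Ψ q.2)))) q.1

theorem measurable_twoTimeKernel {Ψ : ℝ → ℝ} (hΨ : Measurable Ψ) :
    Measurable (fun z : (ℝ × ℝ) × (ℝ × ℝ) => twoTimeKernel Ψ z.1 z.2) := by
  have h1 : Measurable (fun z : (ℝ × ℝ) × (ℝ × ℝ) =>
      ENNReal.ofReal (Real.exp (-(z.1.1 * Ψ (z.1.2 - z.2.2)))) *
      ENNReal.ofReal (Real.exp (-((z.2.1 - z.1.1) * Ψ z.2.2)))) := by fun_prop
  exact h1.indicator (s := {z | z.1.1 ≤ z.2.1}) 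
    (measurableSet_le (f := fun z : (ℝ × ℝ) × (ℝ × ℝ) => z.1.1)
      (g := fun z : (ℝ × ℝ) × (ℝ × ℝ) => z.2.1) (by fun_prop) (by fun_prop))

/-- The double integral of the two-time kernel against a density `η` of frequencies. -/
theorem lintegral_twoTimeKernel_le {Ψ : ℝ → ℝ} (hΨ : Measurable Ψ) {η : ℝ → ℝ≥0∞}
    (hη : Measurable η) (T : ℝ) :
    ∫⁻ z, η z.1.2 * η z.2.2 * twoTimeKernel Ψ z.1 z.2
        ∂(((volume.restrict (Set.Ioc 0 T)).prod volume).prod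
          ((volume.restrict (Set.Ioc 0 T)).prod (volume : Measure ℝ))) ≤
      ∫⁻ y, η y * fullLaplace (Ψ y) * ∫⁻ x, η x * truncLaplace T (Ψ (x - y)) := by
  have hk := measurable_twoTimeKernel hΨ
  have hL := measurable_fullLaplace
  rw [lintegral_prod _ (by fun_prop)]
  -- The later time is integrated over the whole half-line, giving `fullLaplace (Ψ y)`. The earlier
  -- one stays in `(0, T]` and will give `truncLaplace T` at frequency `x - y`.
  have hinner : ∀ p : ℝ × ℝ, ∫⁻ q, η p.2 * η q.2 * twoTimeKernel Ψ p q
      ∂((volume.restrict (Set.Ioc 0 T)).prod (volume : Measure ℝ)) ≤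
      ∫⁻ y, η p.2 * (η y * fullLaplace (Ψ y)) *
        ENNReal.ofReal (Real.exp (-(p.1 * Ψ (p.2 - y)))) := by
    intro p
    have hkp : Measurable (fun q : ℝ × ℝ => twoTimeKernel Ψ p q) :=
      hk.comp (measurable_const.prodMk measurable_id)
    rw [lintegral_prod_symm _ (by fun_prop)]
    refine lintegral_mono fun y => ?_
    have hky : Measurable (fun r : ℝ => twoTimeKernel Ψ p (r, y)) :=
      hkp.comp (measurable_id.prodMk measurable_const)
    simp only
    rw [lintegral_const_mul _ hky]
    calc _ ≤ η p.2 * η y * (ENNReal.ofReal (Real.exp (-(p.1 * Ψ (p.2 - y)))) *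
          fullLaplace (Ψ y)) := by
          gcongr
          refine (setLIntegral_le_lintegral _ _).trans ?_
          simp only [twoTimeKernel]
          rw [lintegral_indicator measurableSet_Ici, lintegral_const_mul _ (by fun_prop)]
          gcongr
          exact lintegral_exp_sub_le _ _
      _ = _ := by ring
  refine (lintegral_mono hinner).trans ?_
  have hm : Measurable (fun z : (ℝ × ℝ) × ℝ => η z.1.2 * (η z.2 * fullLaplace (Ψ z.2)) *
      ENNReal.ofReal (Real.exp (-(z.1.1 * Ψ (z.1.2 - z.2))))) := by fun_prop
  rw [lintegral_lintegral_swap hm.aemeasurable]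
  refine lintegral_mono fun y => ?_
  have hmy : Measurable (fun p : ℝ × ℝ => η p.2 * (η y * fullLaplace (Ψ y)) *
      ENNReal.ofReal (Real.exp (-(p.1 * Ψ (p.2 - y))))) :=
    hm.comp (measurable_id.prodMk measurable_const)
  rw [lintegral_prod_symm _ hmy.aemeasurable]
  have hT : Measurable (fun x => η x * truncLaplace T (Ψ (x - y))) := by
    have := measurable_truncLaplace T
    fun_prop
  rw [← lintegral_const_mul _ hT]
  refine le_of_eq (lintegral_congr fun x => ?_)
  simp only
  rw [lintegral_const_mul _ (by fun_prop), truncLaplace]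
  ring

namespace IsRegularLevy

variable {Ω : Type*} [mΩ : MeasurableSpace Ω] {P : Measure Ω} {Z : ℝ → Ω → ℝ} {Ψ : ℝ → ℝ}

/-- For `s ≤ r` the phase `x Z_s - y Z_r` equals `-y (Z_r - Z_s) + (x - y) Z_s`, whose two terms are
independent. The two summands on the right cover the two orders of the times. -/
theorem enorm_integral_exp_two_time_le (h : IsRegularLevy Z P Ψ) (hΨe : ∀ x, Ψ (-x) = Ψ x)
    {p q : ℝ × ℝ} (hp : 0 ≤ p.1) (hq : 0 ≤ q.1) :
    ‖∫ ω, Complex.exp (Complex.I * (p.2 * Z p.1 ω - q.2 * Z q.1 ω : ℝ)) ∂P‖ₑ ≤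
      twoTimeKernel Ψ p q + twoTimeKernel Ψ q p := by
  have key : ∀ s r u v : ℝ, 0 ≤ s → s ≤ r →
      ‖∫ ω, Complex.exp (Complex.I * (u * (Z r ω - Z s ω) : ℝ)) *
        Complex.exp (Complex.I * (v * Z s ω : ℝ)) ∂P‖ₑ =
        ENNReal.ofReal (Real.exp (-(s * Ψ v))) * ENNReal.ofReal (Real.exp (-((r - s) * Ψ u))) := by
    intro s r u v hs hsr
    have hm : Measurable (fun x : ℝ => Complex.exp (Complex.I * (v * x : ℝ))) := by fun_prop
    rw [h.integral_exp_sub_mul hs hsr u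
      (V := fun ω => Complex.exp (Complex.I * (v * Z s ω : ℝ))) (hm.comp (measurable_eval_comap_Iic Z le_rfl)),
      h.charFun s v hs, enorm_mul, mul_comm, ← ofReal_norm, ← ofReal_norm,
      Complex.norm_real, Complex.norm_real, Real.norm_of_nonneg (Real.exp_pos _).le,
      Real.norm_of_nonneg (Real.exp_pos _).le]
  rcases le_total p.1 q.1 with hpq | hpq
  · refine le_add_right (le_of_eq ?_)
    rw [twoTimeKernel, Set.indicator_of_mem (by exact hpq), ← hΨe q.2, ← key _ _ _ _ hp hpq]
    congr 1
    refine integral_congr_ae (ae_of_all _ fun ω => ?_)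
    simp only
    rw [← Complex.exp_add, ← mul_add, ← Complex.ofReal_add]
    congr 3
    ring
  · refine le_add_left (le_of_eq ?_)
    rw [twoTimeKernel, Set.indicator_of_mem (by exact hpq), ← hΨe (q.2 - p.2), neg_sub,
      ← key _ _ _ _ hq hpq]
    congr 1
    refine integral_congr_ae (ae_of_all _ fun ω => ?_)
    simp only
    rw [← Complex.exp_add, ← mul_add, ← Complex.ofReal_add]
    congr 3
    ring

/-- Second moment bound for the additive functional of the Fourier integral of `κ`. -/
theorem lintegral_enorm_sq_le [IsProbabilityMeasure P] (h : IsRegularLevy Z P Ψ)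
    (hΨ : Measurable Ψ) (hΨe : ∀ x, Ψ (-x) = Ψ x) {κ : ℝ → ℂ} (hκ : Measurable κ)
    (hκi : Integrable κ) (T : ℝ) :
    ∫⁻ ω, ‖∫ s in Set.Ioc 0 T, ∫ x, κ x * Complex.exp (Complex.I * (x * Z s ω : ℝ))‖ₑ ^ 2 ∂P ≤
      2 * ∫⁻ y, ‖κ y‖ₑ * fullLaplace (Ψ y) * ∫⁻ x, ‖κ x‖ₑ * truncLaplace T (Ψ (x - y)) := by
  set μ : Measure (ℝ × ℝ) := (volume.restrict (Set.Ioc 0 T)).prod volume with hμ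
  have hZm : Measurable (fun p : Ω × ℝ => Z p.2 p.1) := h.measurable_uncurry.comp measurable_swap
  obtain ⟨F, hF⟩ : ∃ F : Ω → ℝ × ℝ → ℂ, ∀ ω p, F ω p =
    κ p.2 * Complex.exp (Complex.I * (p.2 * Z p.1 ω : ℝ)) := ⟨_, fun _ _ => rfl⟩
  have hFn : ∀ ω p, ‖F ω p‖ = ‖κ p.2‖ := by
    intro ω p
    rw [hF, norm_mul, mul_comm Complex.I, Complex.norm_exp_ofReal_mul_I, mul_one]
  have hFm : Measurable (fun z : Ω × (ℝ × ℝ) => F z.1 z.2) := by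
    have h1 : Measurable (fun z : Ω × (ℝ × ℝ) => Z z.2.1 z.1) :=
      hZm.comp (measurable_fst.prodMk measurable_snd.fst)
    have h2 : Measurable (fun q : ℝ × ℝ => κ q.1 * Complex.exp (Complex.I * (q.1 * q.2 : ℝ))) := by
      fun_prop
    have hc := h2.comp (measurable_snd.snd.prodMk h1)
    simp only [hF]
    exact hc
  have hκμ : Integrable (fun p : ℝ × ℝ => κ p.2) μ := hκi.comp_snd _
  have hFi : ∀ ω, Integrable (F ω) μ := fun ω =>
    hκμ.mono (hFm.comp (measurable_const.prodMk measurable_id)).aestronglyMeasurable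
      (ae_of_all _ fun p => (hFn ω p).le)
  have hJ : ∀ ω, ∫ s in Set.Ioc 0 T, ∫ x, κ x * Complex.exp (Complex.I * (x * Z s ω : ℝ)) =
      ∫ p, F ω p ∂μ := by
    intro ω
    rw [hμ, integral_prod _ (hFi ω)]
    simp only [hF]
  simp_rw [hJ]
  obtain ⟨G, hG⟩ : ∃ G : Ω → (ℝ × ℝ) × (ℝ × ℝ) → ℂ, ∀ ω z, G ω z =
    F ω z.1 * (starRingEnd ℂ) (F ω z.2) := ⟨_, fun _ _ => rfl⟩
  have hGm : Measurable (fun z : Ω × ((ℝ × ℝ) × (ℝ × ℝ)) => G z.1 z.2) := by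
    simp only [hG]
    have h1 := hFm.comp (measurable_fst.prodMk measurable_snd.fst :
      Measurable (fun z : Ω × ((ℝ × ℝ) × (ℝ × ℝ)) => (z.1, z.2.1)))
    have h2 := hFm.comp (measurable_fst.prodMk measurable_snd.snd :
      Measurable (fun z : Ω × ((ℝ × ℝ) × (ℝ × ℝ)) => (z.1, z.2.2)))
    exact h1.mul (Complex.continuous_conj.measurable.comp h2)
  -- The squared modulus is written as a double integral of `F` against its conjugate, so that the
  -- expectation can be taken inside.
  have hsq : ∀ ω, ((‖∫ p, F ω p ∂μ‖ ^ 2 : ℝ) : ℂ) = ∫ z, G ω z ∂(μ.prod μ) := by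
    intro ω
    simp only [hG]
    rw [integral_prod_mul (F ω) (fun q => (starRingEnd ℂ) (F ω q)), integral_conj,
      Complex.mul_conj, Complex.normSq_eq_norm_sq]
  have hGi : Integrable (fun z : Ω × ((ℝ × ℝ) × (ℝ × ℝ)) => G z.1 z.2) (P.prod (μ.prod μ)) := by
    have h1 : Integrable (fun z : (ℝ × ℝ) × (ℝ × ℝ) => κ z.1.2 * κ z.2.2) (μ.prod μ) :=
      hκμ.mul_prod hκμ
    refine (h1.comp_snd P).mono hGm.aestronglyMeasurable (ae_of_all _ fun z => le_of_eq ?_)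
    rw [hG, norm_mul, RCLike.norm_conj, hFn, hFn, norm_mul]
  have hsqi : Integrable (fun ω => ‖∫ p, F ω p ∂μ‖ ^ 2) P := by
    have := hGi.integral_prod_left
    simp only [← hsq] at this
    exact this.re
  have hstep : ∫⁻ ω, ‖∫ p, F ω p ∂μ‖ₑ ^ 2 ∂P = ‖∫ z, ∫ ω, G ω z ∂P ∂(μ.prod μ)‖ₑ := by
    rw [← integral_integral_swap (f := G) hGi]
    simp_rw [← hsq]
    rw [integral_complex_ofReal, ← ofReal_norm, Complex.norm_real, Real.norm_of_nonneg
      (integral_nonneg fun ω => by positivity), ofReal_integral_eq_lintegral_ofReal hsqi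
      (ae_of_all _ fun ω => by positivity)]
    refine lintegral_congr fun ω => ?_
    rw [ENNReal.ofReal_pow (norm_nonneg _), ofReal_norm]
  have hpt : ∀ z : (ℝ × ℝ) × (ℝ × ℝ), 0 < z.1.1 → 0 < z.2.1 → ‖∫ ω, G ω z ∂P‖ₑ ≤
      ‖κ z.1.2‖ₑ * ‖κ z.2.2‖ₑ * (twoTimeKernel Ψ z.1 z.2 + twoTimeKernel Ψ z.2 z.1) := by
    intro z h1 h2
    have e : ∀ ω, G ω z = (κ z.1.2 * (starRingEnd ℂ) (κ z.2.2)) *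
        Complex.exp (Complex.I * (z.1.2 * Z z.1.1 ω - z.2.2 * Z z.2.1 ω : ℝ)) := by
      intro ω
      rw [hG, hF, hF, map_mul, ← Complex.exp_conj, map_mul, Complex.conj_I, Complex.conj_ofReal,
        Complex.ofReal_sub, mul_sub, sub_eq_add_neg, Complex.exp_add]
      ring_nf
    simp_rw [e]
    rw [integral_const_mul, enorm_mul, enorm_mul, RCLike.enorm_conj]
    gcongr
    exact h.enorm_integral_exp_two_time_le hΨe h1.le h2.le
  have hpos : ∀ᵐ p ∂μ, 0 < p.1 := by
    rw [hμ]
    have : ∀ᵐ s ∂(volume.restrict (Set.Ioc 0 T)), 0 < s := by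
      filter_upwards [ae_restrict_mem measurableSet_Ioc] with s hs using hs.1
    exact Measure.quasiMeasurePreserving_fst.ae this
  have hk := measurable_twoTimeKernel hΨ
  have hk' : Measurable (fun z : (ℝ × ℝ) × (ℝ × ℝ) => twoTimeKernel Ψ z.2 z.1) :=
    hk.comp measurable_swap
  rw [hstep]
  calc _ ≤ ∫⁻ z, ‖∫ ω, G ω z ∂P‖ₑ ∂(μ.prod μ) := enorm_integral_le_lintegral_enorm _
    _ ≤ ∫⁻ z, (‖κ z.1.2‖ₑ * ‖κ z.2.2‖ₑ * twoTimeKernel Ψ z.1 z.2 +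
          ‖κ z.1.2‖ₑ * ‖κ z.2.2‖ₑ * twoTimeKernel Ψ z.2 z.1) ∂(μ.prod μ) := by
        refine lintegral_mono_ae ?_
        filter_upwards [Measure.quasiMeasurePreserving_fst.ae hpos,
          Measure.quasiMeasurePreserving_snd.ae hpos] with z h1 h2
        rw [← mul_add]
        exact hpt z h1 h2
    _ = 2 * ∫⁻ z, ‖κ z.1.2‖ₑ * ‖κ z.2.2‖ₑ * twoTimeKernel Ψ z.1 z.2 ∂(μ.prod μ) := by
        rw [lintegral_add_left (by fun_prop), two_mul]
        congr 1
        rw [← lintegral_prod_swap]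
        refine lintegral_congr fun z => ?_
        simp only [Prod.fst_swap, Prod.snd_swap]
        ring
    _ ≤ _ := by
        gcongr
        exact lintegral_twoTimeKernel_le hΨ hκ.enorm T

/-- The normalized integrand is at most `min (t²) (1 / (a(n)² Ψ(u)))`. It vanishes in the limit off
the origin and is dominated by `(t² + 1) / (1 + Ψ(u))` once `a(n) ≥ 1`. -/
theorem tendsto_lintegral_truncLaplace {Ψ : ℝ → ℝ} (hΨ : Measurable Ψ)
    (hpos : ∀ x, x ≠ 0 → 0 < Ψ x) (hint : Integrable (fun x : ℝ => 1 / (1 + Ψ x)))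
    {a : ℕ → ℝ} (ha : Tendsto a atTop atTop) (t : ℝ) :
    Tendsto (fun n => ENNReal.ofReal (a n ^ 2)⁻¹ * ∫⁻ u, truncLaplace (t ^ 2 * a n ^ 2) (Ψ u))
      atTop (𝓝 0) := by
  have hm : ∀ T, Measurable (fun u => truncLaplace T (Ψ u)) := fun T =>
    (measurable_truncLaplace T).comp hΨ
  have hmeas : ∀ n, Measurable (fun u => ENNReal.ofReal (a n ^ 2)⁻¹ *
      truncLaplace (t ^ 2 * a n ^ 2) (Ψ u)) := fun n => (hm _).const_mul _
  simp_rw [← lintegral_const_mul _ (hm _)]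
  have hne : ∀ᵐ u : ℝ, u ≠ 0 := by simp [ae_iff]
  have h0 : ∫⁻ _ : ℝ, (0 : ℝ≥0∞) = 0 := by simp
  rw [← h0]
  refine tendsto_lintegral_filter_of_dominated_convergence
    (fun u => ENNReal.ofReal ((t ^ 2 + 1) * (1 / (1 + Ψ u)))) ?_ ?_ ?_ ?_
  · exact Eventually.of_forall fun n => hmeas n
  · filter_upwards [ha.eventually_ge_atTop 1] with n hn
    filter_upwards [hne] with u hu
    have hp := hpos u hu
    have ha2 : 1 ≤ a n ^ 2 := one_le_pow₀ hn
    calc _ ≤ ENNReal.ofReal (a n ^ 2)⁻¹ *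
          ENNReal.ofReal (min (t ^ 2 * a n ^ 2) (1 / Ψ u)) := by
          gcongr
          exact truncLaplace_le hp
      _ ≤ _ := by
          rw [← ENNReal.ofReal_mul (by positivity)]
          refine ENNReal.ofReal_le_ofReal ?_
          rw [mul_one_div, le_div_iff₀ (by positivity), mul_assoc, inv_mul_le_iff₀ (by positivity)]
          have h1 := min_le_left (t ^ 2 * a n ^ 2) (1 / Ψ u)
          have h2 : min (t ^ 2 * a n ^ 2) (1 / Ψ u) * Ψ u ≤ 1 :=
            (mul_le_mul_of_nonneg_right (min_le_right _ _) hp.le).trans_eq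
              (one_div_mul_cancel hp.ne')
          nlinarith
  · have := (hint.const_mul (t ^ 2 + 1)).lintegral_lt_top
    exact this.ne
  · filter_upwards [hne] with u hu
    have hp := hpos u hu
    have hlim : Tendsto (fun n => ENNReal.ofReal ((a n ^ 2)⁻¹ * (1 / Ψ u))) atTop (𝓝 0) := by
      have h1 : Tendsto (fun n => (a n ^ 2)⁻¹ * (1 / Ψ u)) atTop (𝓝 (0 * (1 / Ψ u))) :=
        ((tendsto_pow_atTop two_ne_zero).comp ha).inv_tendsto_atTop.mul_const _
      simpa using ENNReal.tendsto_ofReal h1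
    refine tendsto_of_tendsto_of_tendsto_of_le_of_le tendsto_const_nhds hlim
      (fun _ => zero_le) fun n => ?_
    simp only
    rw [ENNReal.ofReal_mul (by positivity)]
    gcongr
    exact (truncLaplace_le hp).trans
      (ENNReal.ofReal_le_ofReal (min_le_right _ _))

/-- The normalized additive functional of the Fourier integral of `κ` tends to zero in `L²`. -/
theorem tendsto_lintegral_enorm_sq [IsProbabilityMeasure P] (h : IsRegularLevy Z P Ψ)
    (hΨ : Measurable Ψ) (hΨe : ∀ x, Ψ (-x) = Ψ x) (hpos : ∀ x, x ≠ 0 → 0 < Ψ x)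
    (hint : Integrable (fun x : ℝ => 1 / (1 + Ψ x))) {κ : ℝ → ℂ} (hκ : Measurable κ)
    (hκi : Integrable κ) {C : ℝ} (hC : ∀ x, ‖κ x‖ ≤ C)
    (hκΨ : ∫⁻ y, ‖κ y‖ₑ * fullLaplace (Ψ y) ≠ ∞)
    {a : ℕ → ℝ} (ha : Tendsto a atTop atTop) (t : ℝ) :
    Tendsto (fun n => ∫⁻ ω, ‖((a n : ℂ))⁻¹ * ∫ s in Set.Ioc 0 (t ^ 2 * a n ^ 2),
      ∫ x, κ x * Complex.exp (Complex.I * (x * Z s ω : ℝ))‖ₑ ^ 2 ∂P) atTop (𝓝 0) := by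
  have hL := (tendsto_lintegral_truncLaplace hΨ hpos hint ha t)
  have hfin : 2 * (ENNReal.ofReal C * ∫⁻ y, ‖κ y‖ₑ * fullLaplace (Ψ y)) ≠ ∞ := by finiteness
  have hL2 := ENNReal.Tendsto.const_mul (a := 2 * (ENNReal.ofReal C *
    ∫⁻ y, ‖κ y‖ₑ * fullLaplace (Ψ y))) hL (Or.inr hfin)
  rw [mul_zero] at hL2
  refine tendsto_of_tendsto_of_tendsto_of_le_of_le' tendsto_const_nhds hL2
    (Eventually.of_forall fun _ => zero_le) ?_
  filter_upwards [ha.eventually_gt_atTop 0] with n hn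
  have he : ‖((a n : ℂ))⁻¹‖ₑ ^ 2 = ENNReal.ofReal (a n ^ 2)⁻¹ := by
    rw [← ofReal_norm, ← ENNReal.ofReal_pow (norm_nonneg _), norm_inv, Complex.norm_real,
      Real.norm_of_nonneg hn.le, inv_pow]
  -- Once `κ` is replaced by its bound `C`, translation invariance removes `y`, and the double
  -- integral factors.
  have hconst : ∀ y, ∫⁻ x, ‖κ x‖ₑ * truncLaplace (t ^ 2 * a n ^ 2) (Ψ (x - y)) ≤
      ENNReal.ofReal C * ∫⁻ x, truncLaplace (t ^ 2 * a n ^ 2) (Ψ x) := by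
    intro y
    rw [← lintegral_sub_right_eq_self (fun x => truncLaplace (t ^ 2 * a n ^ 2) (Ψ x)) y,
      ← lintegral_const_mul' _ _ ENNReal.ofReal_ne_top]
    refine lintegral_mono fun x => ?_
    gcongr
    rw [← ofReal_norm]
    exact ENNReal.ofReal_le_ofReal (hC x)
  simp_rw [enorm_mul, mul_pow]
  rw [lintegral_const_mul' _ _ (by finiteness), he]
  calc _ ≤ ENNReal.ofReal (a n ^ 2)⁻¹ * (2 * ∫⁻ y, ‖κ y‖ₑ * fullLaplace (Ψ y) *
        (ENNReal.ofReal C * ∫⁻ x, truncLaplace (t ^ 2 * a n ^ 2) (Ψ x))) := by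
        gcongr
        refine (h.lintegral_enorm_sq_le hΨ hΨe hκ hκi _).trans ?_
        gcongr with y
        exact hconst y
    _ = _ := by
        have := measurable_fullLaplace
        rw [lintegral_mul_const _ (by fun_prop)]
        ring

end IsRegularLevy

/-! ### Fourier inversion and absolute continuity of the laws. -/

open FourierTransform SchwartzMap ContDiff Manifold in
/-- Fourier inversion almost everywhere for integrable functions with integrable transform. -/
theorem ae_eq_fourierInv_fourier {f : ℝ → ℂ} (hf : Integrable f) (hf' : Integrable (𝓕 f)) :
    f =ᵐ[volume] 𝓕⁻ (𝓕 f) := by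
  have hcont : Continuous (𝓕⁻ (𝓕 f)) :=
    VectorFourier.fourierIntegral_continuous Real.continuous_fourierChar
      (L := -innerₗ ℝ) (by exact continuous_inner.neg) hf'
  -- Tested against a smooth compactly supported function, the transform moves onto the test
  -- function by duality, where Schwartz inversion applies, and then back.
  refine ae_eq_of_integral_contDiff_smul_eq hf.locallyIntegrable hcont.locallyIntegrable
    fun g hg hgs => ?_
  have hGs : HasCompactSupport (fun x => (g x : ℂ)) := hgs.comp_left (g := fun x : ℝ => (x : ℂ)) rfl
  have hGd : ContDiff ℝ ∞ (fun x => (g x : ℂ)) := Complex.ofRealCLM.contDiff.comp hg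
  set G : 𝓢(ℝ, ℂ) := hGs.toSchwartzMap hGd with hG
  have hGx : ∀ x, G x = (g x : ℂ) := fun x => rfl
  have e0 : ∀ x, 𝓕 ((𝓕⁻ G : 𝓢(ℝ, ℂ)) : ℝ → ℂ) x = G x := by
    intro x
    rw [← fourier_coe, FourierTransform.fourier_fourierInv_eq]
  have e1 : ∫ x, G x • f x = ∫ x, (𝓕⁻ G) x • 𝓕 f x := by
    simp_rw [← e0]
    simpa using! VectorFourier.integral_fourierIntegral_smul_eq_flip (L := innerₗ ℝ)
      Real.continuous_fourierChar continuous_inner ((𝓕⁻ G : 𝓢(ℝ, ℂ)).integrable (μ := volume)) hf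
  have e2 : ∫ x, (𝓕⁻ G) x • 𝓕 f x = ∫ x, G x • 𝓕⁻ (𝓕 f) x := by
    simp_rw [fourierInv_coe]
    have hflip : (-innerₗ ℝ : ℝ →ₗ[ℝ] ℝ →ₗ[ℝ] ℝ).flip = -innerₗ ℝ := by
      ext; simp
    have := VectorFourier.integral_fourierIntegral_smul_eq_flip (L := -innerₗ ℝ)
      Real.continuous_fourierChar (by exact continuous_inner.neg) (G.integrable (μ := volume)) hf'
    rw [hflip] at this
    exact this
  have e3 := e1.trans e2
  simp only [hGx, smul_eq_mul] at e3
  simpa only [Complex.real_smul] using e3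

open FourierTransform in
theorem fourier_eq_angularFourier (f : ℝ → ℂ) (ξ : ℝ) :
    𝓕 f ξ = angularFourier f (2 * Real.pi * ξ) := by
  rw [Real.fourier_eq', angularFourier]
  refine integral_congr_ae (ae_of_all _ fun y => ?_)
  simp only [smul_eq_mul]
  congr 2
  simp only [RCLike.inner_apply, conj_trivial]
  push_cast
  ring

open FourierTransform in
theorem fourierInv_fourier_eq_integral_angularFourier (f : ℝ → ℂ) (y : ℝ) :
    𝓕⁻ (𝓕 f) y = ∫ x : ℝ, (((2 * Real.pi)⁻¹ : ℝ) : ℂ) * angularFourier f x *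
      Complex.exp (Complex.I * (x * y : ℝ)) := by
  have h := Measure.integral_comp_mul_left (fun x : ℝ => (((2 * Real.pi)⁻¹ : ℝ) : ℂ) *
    angularFourier f x * Complex.exp (Complex.I * (x * y : ℝ))) (2 * Real.pi)
  rw [abs_of_pos (by positivity)] at h
  have h2 : ∫ x : ℝ, (((2 * Real.pi)⁻¹ : ℝ) : ℂ) * angularFourier f x *
      Complex.exp (Complex.I * (x * y : ℝ)) = (2 * Real.pi) • ∫ x : ℝ,
        (((2 * Real.pi)⁻¹ : ℝ) : ℂ) * angularFourier f (2 * Real.pi * x) *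
        Complex.exp (Complex.I * ((2 * Real.pi * x) * y : ℝ)) := by
    rw [h, smul_smul, mul_inv_cancel₀ (by positivity), one_smul]
  rw [h2, ← integral_smul, Real.fourierInv_eq']
  refine integral_congr_ae (ae_of_all _ fun x => ?_)
  have hp : (Real.pi : ℂ) ≠ 0 := by exact_mod_cast Real.pi_pos.ne'
  simp only [smul_eq_mul, fourier_eq_angularFourier, Complex.real_smul]
  have e : Complex.exp (((2 * Real.pi * inner ℝ x y : ℝ) : ℂ) * Complex.I) =
      Complex.exp (Complex.I * ((2 * Real.pi * x) * y : ℝ)) := by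
    congr 1
    simp only [RCLike.inner_apply, conj_trivial]
    push_cast
    ring
  rw [e]
  push_cast
  field_simp

theorem ae_eq_integral_angularFourier {f : ℝ → ℂ} (hf : Integrable f)
    (hf' : Integrable (angularFourier f)) :
    f =ᵐ[volume] fun y => ∫ x : ℝ, (((2 * Real.pi)⁻¹ : ℝ) : ℂ) * angularFourier f x *
      Complex.exp (Complex.I * (x * y : ℝ)) := by
  have h1 : Integrable (FourierTransform.fourier f) := by
    rw [funext (fourier_eq_angularFourier f)]
    exact hf'.comp_mul_left' (by positivity)
  filter_upwards [ae_eq_fourierInv_fourier hf h1] with y hy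
  rw [hy, fourierInv_fourier_eq_integral_angularFourier]

theorem norm_angularFourier_le (f : ℝ → ℂ) (x : ℝ) : ‖angularFourier f x‖ ≤ ∫ y, ‖f y‖ := by
  refine (norm_integral_le_integral_norm _).trans (le_of_eq ?_)
  refine integral_congr_ae (ae_of_all _ fun y => ?_)
  have e : -(Complex.I * (x : ℂ) * (y : ℂ)) = ((-(x * y) : ℝ) : ℂ) * Complex.I := by
    push_cast
    ring
  simp only [norm_mul, e, Complex.norm_exp_ofReal_mul_I, one_mul]

theorem measurable_angularFourier {f : ℝ → ℂ} (hf : AEStronglyMeasurable f) :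
    Measurable (angularFourier f) := by
  obtain ⟨f', hf', hff'⟩ := hf
  have h : angularFourier f = angularFourier f' := by
    funext x
    refine integral_congr_ae ?_
    filter_upwards [hff'] with y hy
    rw [hy]
  have hm := hf'.measurable
  have h2 : StronglyMeasurable (fun p : ℝ × ℝ =>
      Complex.exp (-(Complex.I * (p.1 : ℂ) * (p.2 : ℂ))) * f' p.2) := by
    refine Measurable.stronglyMeasurable ?_
    fun_prop
  rw [h]
  exact h2.integral_prod_right'.measurable

open FourierTransform SchwartzMap ContDiff Manifold in
/-- A finite measure on the line with integrable characteristic function is absolutely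
continuous. -/
theorem absolutelyContinuous_of_integrable_charFun {μ : Measure ℝ} [IsFiniteMeasure μ]
    {φ : ℝ → ℂ} (hφ : ∀ x, ∫ y, Complex.exp (Complex.I * (x * y : ℝ)) ∂μ = φ x)
    (hφi : Integrable φ) : μ ≪ volume := by
  set C : ℝ := ∫ ξ, ‖φ (2 * Real.pi * ξ)‖ with hC
  have hC0 : 0 ≤ C := integral_nonneg fun _ => norm_nonneg _
  have hφi' : Integrable (fun ξ => φ (2 * Real.pi * ξ)) := hφi.comp_mul_left' (by positivity)
  -- By Parseval `∫ G dμ` is `∫ φ(2πξ) Ĝ(ξ) dξ`, and `|Ĝ|` is at most the `L¹` norm of `G`. So `μ`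
  -- is controlled by `C` times Lebesgue measure on test functions.
  have key : ∀ G : 𝓢(ℝ, ℂ), ‖∫ y, G y ∂μ‖ ≤ C * ∫ y, ‖G y‖ := by
    intro G
    have e0 : ∀ y, G y = ∫ ξ, Complex.exp ((2 * Real.pi * (ξ * y) : ℝ) * Complex.I) *
      (𝓕 G : 𝓢(ℝ, ℂ)) ξ := by
      intro y
      have h1 : 𝓕⁻ ((𝓕 G : 𝓢(ℝ, ℂ)) : ℝ → ℂ) y = G y := by
        rw [← fourierInv_coe, FourierTransform.fourierInv_fourier_eq]
      rw [← h1, Real.fourierInv_eq']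
      simp [mul_comm]
    have hint : Integrable (fun p : ℝ × ℝ =>
        Complex.exp ((2 * Real.pi * (p.2 * p.1) : ℝ) * Complex.I) *
          (𝓕 G : 𝓢(ℝ, ℂ)) p.2) (μ.prod volume) := by
      refine ((𝓕 G : 𝓢(ℝ, ℂ)).integrable.comp_snd μ).mono ?_ (ae_of_all _ fun p => ?_)
      · exact (Continuous.mul (by fun_prop) ((𝓕 G : 𝓢(ℝ, ℂ)).continuous.comp continuous_snd)).aestronglyMeasurable
      · rw [norm_mul, Complex.norm_exp_ofReal_mul_I, one_mul]
    simp_rw [e0]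
    rw [integral_integral_swap (f := fun y ξ =>
      Complex.exp ((2 * Real.pi * (ξ * y) : ℝ) * Complex.I) *
      (𝓕 G : 𝓢(ℝ, ℂ)) ξ) hint]
    have e1 : ∀ ξ, ∫ y, Complex.exp ((2 * Real.pi * (ξ * y) : ℝ) * Complex.I) *
      (𝓕 G : 𝓢(ℝ, ℂ)) ξ ∂μ =
        φ (2 * Real.pi * ξ) * (𝓕 G : 𝓢(ℝ, ℂ)) ξ := by
      intro ξ
      rw [integral_mul_const, ← hφ]
      simp only [mul_comm Complex.I, mul_assoc]
    simp_rw [e1]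
    simp_rw [← e0]
    rw [hC, ← integral_mul_const]
    refine norm_integral_le_of_norm_le (hφi'.norm.mul_const _) (ae_of_all _ fun ξ => ?_)
    rw [norm_mul]
    gcongr
    rw [fourier_coe]
    exact VectorFourier.norm_fourierIntegral_le_integral_norm _ _ _ _ _
  -- A smooth bump equal to one on `K` and supported in a bounded open set of volume below `ε`
  -- transfers the bound to compact null sets; inner regularity then gives all null sets.
  have hK : ∀ K : Set ℝ, IsCompact K → volume K = 0 → μ K = 0 := by
    intro K hKc hK0
    have hle : ∀ ε : ℝ, 0 < ε → (μ K).toReal ≤ C * ε := by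
      intro ε hε
      obtain ⟨U, hKU, hUo, hUε⟩ := K.exists_isOpen_lt_of_lt (ENNReal.ofReal ε)
        (μ := volume) (by rw [hK0]; simpa using hε)
      obtain ⟨R, hR⟩ := hKc.isBounded.subset_ball 0
      set V := U ∩ Metric.ball 0 R with hV
      have hVo : IsOpen V := hUo.inter Metric.isOpen_ball
      have hKV : K ⊆ V := Set.subset_inter hKU hR
      obtain ⟨g, hg0, hg1, hg01⟩ := exists_contMDiffMap_zero_one_of_isClosed 𝓘(ℝ, ℝ) (n := ⊤)
        hVo.isClosed_compl hKc.isClosed (Set.disjoint_compl_left_iff_subset.2 hKV)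
      have hgd : ContDiff ℝ ∞ g := g.contMDiff.contDiff
      have hgs : HasCompactSupport g := by
        refine HasCompactSupport.intro (isCompact_closedBall 0 R) fun x hx => hg0 fun hxV => hx ?_
        exact Metric.ball_subset_closedBall hxV.2
      have hGs : HasCompactSupport (fun x => (g x : ℂ)) :=
        hgs.comp_left (g := fun x : ℝ => (x : ℂ)) rfl
      have hGd : ContDiff ℝ ∞ (fun x => (g x : ℂ)) := Complex.ofRealCLM.contDiff.comp hgd
      have hk := key (hGs.toSchwartzMap hGd)
      have hGx : ∀ x, (hGs.toSchwartzMap hGd) x = (g x : ℂ) := fun x => rfl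
      simp_rw [hGx, Complex.norm_real] at hk
      rw [integral_complex_ofReal, Complex.norm_real, Real.norm_of_nonneg
        (integral_nonneg fun x => (hg01 x).1)] at hk
      have hgle : ∀ x, g x ≤ V.indicator 1 x := by
        intro x
        by_cases hx : x ∈ V
        · simpa [hx] using (hg01 x).2
        · simpa [hx] using (hg0 hx).le
      have hVε : volume V < ENNReal.ofReal ε := (measure_mono Set.inter_subset_left).trans_lt hUε
      have h1 : ∫ x, ‖g x‖ ≤ ε := by
        calc ∫ x, ‖g x‖ ≤ ∫ x, V.indicator 1 x := by
              refine integral_mono (hgd.continuous.integrable_of_hasCompactSupport hgs).norm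
                ((integrable_indicator_iff hVo.measurableSet).2
                  (integrableOn_const hVε.ne_top)) fun x => ?_
              simp only [Real.norm_of_nonneg (hg01 x).1]
              exact hgle x
          _ = (volume V).toReal := by
              rw [integral_indicator_one hVo.measurableSet]; rfl
          _ ≤ ε := ENNReal.toReal_le_of_le_ofReal hε.le hVε.le
      have h2 : (μ K).toReal ≤ ∫ x, g x ∂μ := by
        have : (μ K).toReal = ∫ x, K.indicator 1 x ∂μ := by
          rw [integral_indicator_one hKc.measurableSet]; rfl
        rw [this]
        refine integral_mono ((integrable_indicator_iff hKc.measurableSet).2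
          (integrableOn_const (measure_ne_top _ _)))
          (hgd.continuous.integrable_of_hasCompactSupport hgs) fun x => ?_
        by_cases hx : x ∈ K
        · simpa [hx] using (hg1 hx).ge
        · simpa [hx] using (hg01 x).1
      exact h2.trans (hk.trans (by gcongr))
    have h0 : (μ K).toReal ≤ 0 := by
      refine le_of_forall_pos_le_add fun ε hε => ?_
      have := hle (ε / (C + 1)) (by positivity)
      refine this.trans ?_
      rw [zero_add, mul_div_assoc', div_le_iff₀ (by positivity)]
      nlinarith
    have := le_antisymm h0 ENNReal.toReal_nonneg
    exact ((ENNReal.toReal_eq_zero_iff _).1 this).resolve_right (measure_ne_top _ _)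
  refine Measure.AbsolutelyContinuous.mk fun N hN hN0 => ?_
  rw [hN.measure_eq_iSup_isCompact]
  simp only [ENNReal.iSup_eq_zero]
  exact fun K hKN hKc => hK K hKc (measure_mono_null hKN hN0)

/-- The threshold `2 / s` gives `s Ψ(x) ≥ 2 log (|x| + 1)` for large `|x|`, hence decay like `(|x| +
1)⁻²`. The constant in front of `1 / (1 + x²)` absorbs the bounded region. -/
theorem integrable_exp_neg_mul_of_tendsto_div_log {Ψ : ℝ → ℝ} (hΨ : Measurable Ψ)
    (hΨr : ∀ x, Ψ x = Ψ |x|) (hΨ0 : ∀ x, 0 ≤ Ψ x)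
    (hlog : Tendsto (fun x : ℝ => Ψ x / Real.log (|x| + 1)) atTop atTop) {s : ℝ} (hs : 0 < s) :
    Integrable (fun x => Real.exp (-(s * Ψ x))) := by
  obtain ⟨R, hR⟩ := (hlog.eventually_ge_atTop (2 / s)).exists_forall_of_atTop
  refine (integrable_inv_one_add_sq.const_mul (1 + (|R| + 1) ^ 2)).mono (by fun_prop)
    (ae_of_all _ fun x => ?_)
  rw [Real.norm_of_nonneg (Real.exp_pos _).le, Real.norm_of_nonneg (by positivity),
    ← div_eq_mul_inv, le_div_iff₀ (by positivity)]
  rcases le_or_gt (|R| + 1) |x| with h | h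
  · have hx1 : 1 < |x| + 1 := by linarith [abs_nonneg R]
    have hl : 0 < Real.log (|x| + 1) := Real.log_pos hx1
    have h1 := hR |x| ((le_abs_self R).trans (by linarith))
    rw [abs_abs, le_div_iff₀ hl, ← hΨr] at h1
    have h2 : 2 * Real.log (|x| + 1) ≤ s * Ψ x := by
      calc 2 * Real.log (|x| + 1) = s * (2 / s * Real.log (|x| + 1)) := by field_simp
        _ ≤ _ := by gcongr
    have h3 : Real.exp (-(s * Ψ x)) ≤ ((|x| + 1) ^ 2)⁻¹ := by
      rw [Real.exp_neg]
      gcongr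
      rw [← Real.log_le_iff_le_exp (by positivity), Real.log_pow]
      exact_mod_cast h2
    calc _ ≤ ((|x| + 1) ^ 2)⁻¹ * (1 + x ^ 2) := by gcongr
      _ ≤ 1 := by
        rw [inv_mul_le_iff₀ (by positivity), mul_one, ← sq_abs x]
        nlinarith [abs_nonneg x]
      _ ≤ _ := by nlinarith [sq_nonneg (|R| + 1)]
  · have h1 : Real.exp (-(s * Ψ x)) ≤ 1 := by
      rw [Real.exp_le_one_iff, neg_nonpos]
      exact mul_nonneg hs.le (hΨ0 x)
    have h2 : x ^ 2 ≤ (|R| + 1) ^ 2 := by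
      rw [← sq_abs x]
      gcongr
    calc _ ≤ 1 * (1 + x ^ 2) := by gcongr
      _ ≤ _ := by linarith

namespace IsRegularLevy

variable {Ω : Type*} [mΩ : MeasurableSpace Ω] {P : Measure Ω} {Z : ℝ → Ω → ℝ} {Ψ : ℝ → ℝ}

/-- Functions that agree almost everywhere agree along almost every path. -/
theorem ae_integral_comp_eq [IsProbabilityMeasure P] (h : IsRegularLevy Z P Ψ)
    (hΨi : ∀ s, 0 < s → Integrable (fun x => Real.exp (-(s * Ψ x)))) {f g : ℝ → ℂ}
    (hfg : f =ᵐ[volume] g) (T : ℝ) :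
    ∀ᵐ ω ∂P, (fun s => f (Z s ω)) =ᵐ[volume.restrict (Set.Ioc 0 T)] fun s => g (Z s ω) := by
  -- A measurable null superset of the disagreement set is needed to exchange the two
  -- almost-everywhere quantifiers.
  set N := toMeasurable volume {y | f y ≠ g y} with hN
  have hN0 : volume N = 0 := by rw [hN, measure_toMeasurable]; exact hfg
  have hNm : MeasurableSet N := measurableSet_toMeasurable _ _
  have hs : ∀ᵐ s ∂(volume.restrict (Set.Ioc 0 T)), ∀ᵐ ω ∂P, Z s ω ∉ N := by
    filter_upwards [ae_restrict_mem measurableSet_Ioc] with s hs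
    have hac : P.map (Z s) ≪ volume := by
      have := Measure.isProbabilityMeasure_map (μ := P) (h.measurable s).aemeasurable
      refine absolutelyContinuous_of_integrable_charFun
        (φ := fun x => (Real.exp (-(s * Ψ x)) : ℂ)) (fun x => ?_) (hΨi s hs.1).ofReal
      rw [integral_map (h.measurable s).aemeasurable (by fun_prop), h.charFun s x hs.1.le]
    have h0 := hac hN0
    rw [Measure.map_apply (h.measurable s) hNm] at h0
    exact measure_eq_zero_iff_ae_notMem.1 h0
  rw [Measure.ae_ae_comm (p := fun s ω => Z s ω ∉ N) (h.measurable_uncurry hNm.compl)] at hs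
  filter_upwards [hs] with ω hω
  filter_upwards [hω] with s hsω
  by_contra hne
  exact hsω (subset_toMeasurable _ _ hne)

end IsRegularLevy

/-! ### Regularization of the given process. -/

/-- For a process with independent increments started at zero, an increment is independent of the
values of the process up to its starting time. -/
theorem ProbabilityTheory.HasIndepIncrements.indepFun_past {Ω : Type*} [MeasurableSpace Ω]
    {P : Measure Ω} [IsProbabilityMeasure P] {X : ℝ≥0 → Ω → ℝ} (hX : HasIndepIncrements X P)
    (hm : ∀ t, Measurable (X t)) (h0 : ∀ᵐ ω ∂P, X 0 ω = 0) {s τ : ℝ≥0} (hsτ : s ≤ τ) :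
    IndepFun (fun ω (r : Set.Iic s) => X r ω) (fun ω => X τ ω - X s ω) P := by
  refine IndepFun.process_indepFun (fun r => hm r) ((hm τ).sub (hm s)) fun I => ?_
  set J : Finset ℝ≥0 := insert 0 (I.image fun r : Set.Iic s => (r : ℝ≥0)) with hJ
  have hJs : ∀ r ∈ J, r ≤ s := by
    intro r hr
    rcases Finset.mem_insert.1 hr with rfl | hr
    · exact zero_le
    · obtain ⟨q, -, rfl⟩ := Finset.mem_image.1 hr
      exact q.2
  let e := J.orderEmbOfFin rfl
  -- The sequence lists `J` in increasing order, then `s`, then `τ` forever, so the increment of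
  -- index `J.card` is the one from `s` to `τ`.
  let θ : ℕ → ℝ≥0 := fun i => if h : i < J.card then e ⟨i, h⟩ else if i = J.card then s else τ
  have heJ : ∀ i, e i ≤ s := fun i => hJs _ (J.orderEmbOfFin_mem rfl i)
  have hθ : Monotone θ := by
    intro i j hij
    simp only [θ]
    split_ifs with h1 h2 h3 h4 h5 h6
    · exact e.monotone hij
    · exact heJ _
    · exact (heJ _).trans hsτ
    all_goals first | omega | exact le_rfl
  have hind := (hX.nat hθ).indepFun_finset (Finset.range J.card) {J.card} (by simp)
    fun i => (hm _).sub (hm _)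
  have hθJ : ∀ r ∈ J, ∃ i < J.card, θ i = r := by
    intro r hr
    have : r ∈ Set.range e := by rw [J.range_orderEmbOfFin]; exact hr
    obtain ⟨i, rfl⟩ := this
    exact ⟨i, i.2, by simp [θ]⟩
  have hsum : ∀ ω j, ∑ i ∈ Finset.range j, (X (θ (i + 1)) ω - X (θ i) ω) =
      X (θ j) ω - X (θ 0) ω := fun ω j => Finset.sum_range_sub (fun i => X (θ i) ω) j
  choose! idx hidx hidxθ using hθJ
  have h0J : (0 : ℝ≥0) ∈ J := Finset.mem_insert_self _ _
  have hIJ : ∀ r : I, ((r : Set.Iic s) : ℝ≥0) ∈ J := fun r =>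
    Finset.mem_insert_of_mem (Finset.mem_image_of_mem _ r.2)
  -- `X r - X 0` is recovered as a difference of two partial sums of increments; the unknown `X (θ
  -- 0)` cancels.
  have hφ : Measurable fun (x : Finset.range J.card → ℝ) (r : I) =>
      ∑ i : Finset.range J.card, ((if (i : ℕ) < idx ((r : Set.Iic s) : ℝ≥0) then x i else 0) -
        (if (i : ℕ) < idx 0 then x i else 0)) :=
    measurable_pi_lambda _ fun r => Finset.measurable_fun_sum _ fun i _ => by
      refine Measurable.sub ?_ ?_ <;> split_ifs <;> fun_prop
  have hψ : Measurable fun x : ({J.card} : Finset ℕ) → ℝ =>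
      x ⟨J.card, Finset.mem_singleton_self _⟩ := measurable_pi_apply _
  have hcomp := hind.comp hφ hψ
  have hval : ∀ ω, ∀ r ∈ J, ∑ i : Finset.range J.card,
      (if (i : ℕ) < idx r then X (θ (i + 1)) ω - X (θ i) ω else 0) = X r ω - X (θ 0) ω := by
    intro ω r hr
    rw [Finset.sum_coe_sort (Finset.range J.card)
      (fun i => if i < idx r then X (θ (i + 1)) ω - X (θ i) ω else 0), ← Finset.sum_filter,
      ← hidxθ r hr, ← hsum, hidxθ r hr]
    refine Finset.sum_congr ?_ fun _ _ => rfl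
    ext i
    have := hidx r hr
    simp only [Finset.mem_filter, Finset.mem_range]
    omega
  refine hcomp.congr ?_ ?_
  · filter_upwards [h0] with ω hω
    funext r
    simp only [Function.comp_apply, Finset.sum_sub_distrib]
    rw [hval ω _ (hIJ r), hval ω _ h0J, hω]
    ring
  · refine ae_of_all _ fun ω => ?_
    simp [θ]

/-- A Lévy process with a real radial exponent has a regularized modification. -/
theorem IsLevyProcess.exists_isRegularLevy {Ω : Type*} [MeasurableSpace Ω] {P : Measure Ω}
    [IsProbabilityMeasure P] {X : ℝ≥0 → Ω → ℝ} (hX : IsLevyProcess X P) {Ψ : ℝ → ℝ}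
    (hXΨ : HasCharExponent X P Ψ) (hΨ : ∀ x, Ψ x = Ψ |x|) :
    ∃ Z : ℝ → Ω → ℝ, IsRegularLevy Z P Ψ ∧
      ∀ᵐ ω ∂P, ∀ s : ℝ, Z s ω = X s.toNNReal ω := by
  -- Paths in a measurable null set containing all irregular ones are replaced by zero. Each
  -- single-time variable changes only on a null set, so laws and independence are kept.
  obtain ⟨N, hNsub, hNm, hN0⟩ := exists_measurable_superset_of_null (ae_iff.1 hX.cadlag)
  have hcad : ∀ ω ∉ N, ∀ t : ℝ≥0, ContinuousWithinAt (fun s => X s ω) (Set.Ici t) t := by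
    intro ω hω t
    by_contra hc
    exact hω (hNsub fun hall => hc (hall t).1)
  have hNae : ∀ᵐ ω ∂P, ω ∉ N := measure_eq_zero_iff_ae_notMem.1 hN0
  have hmod : ∀ s : ℝ, X s.toNNReal =ᵐ[P] Nᶜ.indicator (X s.toNNReal) := by
    intro s
    filter_upwards [hNae] with ω hω
    rw [Set.indicator_of_mem (by exact hω)]
  have hchar : ∀ (s : ℝ≥0) (u : ℝ), ∫ ω, Complex.exp (Complex.I * (u * X s ω : ℝ)) ∂P =
      (Real.exp (-(s * Ψ u)) : ℂ) := by
    intro s u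
    have h := hXΨ s (-u)
    rw [hΨ, abs_neg, ← hΨ] at h
    rw [Complex.ofReal_exp]
    convert h using 1
    · refine integral_congr_ae (ae_of_all _ fun ω => ?_)
      simp only
      congr 1
      push_cast
      ring
    · push_cast
      rfl
  have hexp : ∀ u : ℝ, Measurable (fun x : ℝ => Complex.exp (Complex.I * (u * x : ℝ))) := by
    intro u
    fun_prop
  refine ⟨fun s => Nᶜ.indicator (X s.toNNReal), ⟨fun s => ?_, fun ω s => ?_, fun s τ hs hsτ => ?_,
    fun s τ u hs hsτ => ?_, fun s u hs => ?_⟩, ?_⟩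
  · exact (hX.measurable _).indicator hNm.compl
  · by_cases hω : ω ∈ N
    · have : (fun r : ℝ => Nᶜ.indicator (X r.toNNReal) ω) = fun _ => 0 :=
        funext fun r => Set.indicator_of_notMem (by simpa using hω) _
      rw [this]
      exact continuousWithinAt_const
    · have : (fun r : ℝ => Nᶜ.indicator (X r.toNNReal) ω) = fun r => X r.toNNReal ω :=
        funext fun r => Set.indicator_of_mem (by exact hω) _
      rw [this]
      exact (hcad ω hω s.toNNReal).comp (f := Real.toNNReal) (t := Set.Ici s.toNNReal)
        continuous_real_toNNReal.continuousWithinAt fun r hr =>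
          Real.toNNReal_le_toNNReal (le_of_lt hr)
  · have h1 := hX.indep_increments.indepFun_past hX.measurable hX.start_zero
      (Real.toNNReal_le_toNNReal hsτ)
    have h2 := h1.comp (φ := fun (x : Set.Iic s.toNNReal → ℝ) (r : Set.Iic s) =>
      x ⟨(r : ℝ).toNNReal, Real.toNNReal_le_toNNReal r.2⟩) (ψ := fun y : ℝ => y)
      (by fun_prop) (by fun_prop)
    have h3 : IndepFun (fun ω (r : Set.Iic s) => X (r : ℝ).toNNReal ω)
      (fun ω => X τ.toNNReal ω - X s.toNNReal ω) P := h2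
    exact (h3.process_congr_left fun r => hmod r).congr (ae_eq_refl _)
      ((hmod τ).sub (hmod s))
  · have hst := hX.stationary_increments s.toNNReal (τ - s).toNNReal
    rw [← Real.toNNReal_add hs (sub_nonneg.2 hsτ), add_sub_cancel] at hst
    have h1 := (hst.comp (hexp u)).integral_eq
    have h2 := hchar (τ - s).toNNReal u
    rw [Real.coe_toNNReal _ (sub_nonneg.2 hsτ)] at h2
    rw [← h2]
    refine Eq.trans (integral_congr_ae ?_) h1
    filter_upwards [hmod τ, hmod s] with ω h3 h4
    simp only [Function.comp_apply]
    rw [h3, h4]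
  · have h2 := hchar s.toNNReal u
    rw [Real.coe_toNNReal _ hs] at h2
    rw [← h2]
    refine integral_congr_ae ?_
    filter_upwards [hmod s] with ω h3
    rw [h3]
  · filter_upwards [hNae] with ω hω s
    rw [Set.indicator_of_mem (by exact hω)]

/-! ### Uniform integrability and estimates on the exponent. -/

/-- A sequence bounded in `L²` is uniformly integrable. -/
theorem uniformIntegrable_of_integral_sq_le {Ω ι : Type*} [MeasurableSpace Ω] {P : Measure Ω}
    [IsFiniteMeasure P] {Y : ι → Ω → ℝ} (hY : ∀ i, AEStronglyMeasurable (Y i) P) {C : ℝ}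
    (hi : ∀ i, Integrable (fun ω => Y i ω ^ 2) P) (hC : ∀ i, ∫ ω, Y i ω ^ 2 ∂P ≤ C) :
    UniformIntegrable Y 1 P := by
  refine uniformIntegrable_of le_rfl (by simp) hY fun ε hε => ?_
  -- Above a level `K` one has `|Y| ≤ Y² / K`, so the tail is at most `C / K`; this `K` makes it at
  -- most `ε`.
  refine ⟨Real.toNNReal (|C| / ε + 1), fun i => ?_⟩
  have hK : 0 < |C| / ε + 1 := by positivity
  rw [eLpNorm_one_eq_lintegral_enorm]
  have hpt : ∀ ω, ‖({x | Real.toNNReal (|C| / ε + 1) ≤ ‖Y i x‖₊}.indicator (Y i)) ω‖ₑ ≤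
      ENNReal.ofReal ((|C| / ε + 1)⁻¹ * Y i ω ^ 2) := by
    intro ω
    by_cases hω : ω ∈ {x | Real.toNNReal (|C| / ε + 1) ≤ ‖Y i x‖₊}
    · rw [Set.indicator_of_mem hω, ← ofReal_norm]
      refine ENNReal.ofReal_le_ofReal ?_
      have h1 : |C| / ε + 1 ≤ |Y i ω| := by
        have := Real.toNNReal_le_iff_le_coe.1 hω
        simpa using this
      rw [Real.norm_eq_abs, ← sq_abs, ← div_eq_inv_mul, le_div_iff₀ hK, sq]
      gcongr
    · rw [Set.indicator_of_notMem hω]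
      simp
  refine (lintegral_mono hpt).trans ?_
  rw [← ofReal_integral_eq_lintegral_ofReal ((hi i).const_mul _)
    (ae_of_all _ fun ω => by positivity), integral_const_mul]
  refine ENNReal.ofReal_le_ofReal ?_
  rw [inv_mul_le_iff₀ hK]
  have h1 : (|C| / ε + 1) * ε = |C| + ε := by field_simp
  rw [h1]
  linarith [hC i, le_abs_self C]

section Exponent

variable {Ψ : ℝ → ℝ}

theorem measurable_of_radial_monotoneOn (hr : ∀ x, Ψ x = Ψ |x|)
    (hmono : MonotoneOn Ψ (Set.Ici 0)) : Measurable Ψ := by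
  have h1 : Monotone (fun x => Ψ (max x 0)) := fun x y hxy =>
    hmono (le_max_right x 0 : (0 : ℝ) ≤ max x 0) (le_max_right y 0 : (0 : ℝ) ≤ max y 0) (max_le_max_right _ hxy)
  have h2 : Ψ = (fun x => Ψ (max x 0)) ∘ fun x => |x| := by
    funext x
    simp [← hr]
  rw [h2]
  exact h1.measurable.comp measurable_abs

theorem ellLower_mul_sq_le (h0 : ∀ x, 0 ≤ Ψ x) {δ v : ℝ} (hv : |v| ≤ δ) :
    ellLower Ψ δ * v ^ 2 ≤ Ψ v := by
  rcases eq_or_ne v 0 with rfl | hv0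
  · simpa using h0 0
  · rw [← le_div_iff₀ (by positivity)]
    refine csInf_le ⟨0, ?_⟩ ⟨v, ⟨hv0, hv⟩, rfl⟩
    rintro _ ⟨x, -, rfl⟩
    have := h0 x
    positivity

/-- The quadratic limit gives positivity near the origin, and monotonicity carries it outward. -/
theorem pos_of_tendsto_div_sq (hr : ∀ x, Ψ x = Ψ |x|) (hmono : MonotoneOn Ψ (Set.Ici 0))
    {ℓ : ℝ} (hℓ : 0 < ℓ) (hlim : Tendsto (fun x : ℝ => Ψ x / x ^ 2) (𝓝[>] 0) (𝓝 ℓ)) {x : ℝ}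
    (hx : x ≠ 0) : 0 < Ψ x := by
  have h1 := hlim.eventually (lt_mem_nhds hℓ)
  have h2 : ∀ᶠ y : ℝ in 𝓝[>] 0, y < |x| :=
    nhdsWithin_le_nhds (Iio_mem_nhds (abs_pos.2 hx))
  obtain ⟨y, ⟨hy1, hy2⟩, hy3⟩ := ((h1.and h2).and self_mem_nhdsWithin).exists
  have hy0 : (0 : ℝ) < y := hy3
  have h3 : 0 < Ψ y := by
    have := mul_pos hy1 (pow_pos hy0 2)
    rwa [div_mul_cancel₀ _ (by positivity)] at this
  rw [hr]
  exact h3.trans_le (hmono hy0.le (abs_nonneg x) hy2.le)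

/-- Near the origin the quotient exceeds `ℓ / 2`. On `η ≤ |x| ≤ δ` the numerator is at least `Ψ(η/2)
> 0` and the denominator at most `δ²`. -/
theorem ellLower_pos (hr : ∀ x, Ψ x = Ψ |x|) (hmono : MonotoneOn Ψ (Set.Ici 0))
    {ℓ : ℝ} (hℓ : 0 < ℓ) (hlim : Tendsto (fun x : ℝ => Ψ x / x ^ 2) (𝓝[>] 0) (𝓝 ℓ)) {δ : ℝ}
    (hδ : 0 < δ) : 0 < ellLower Ψ δ := by
  have h1 := hlim.eventually (lt_mem_nhds (half_lt_self hℓ))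
  obtain ⟨η, hη, hηs⟩ := mem_nhdsGT_iff_exists_Ioo_subset.1 h1
  have hη0 : (0 : ℝ) < η := hη
  have hp : 0 < Ψ (η / 2) := pos_of_tendsto_div_sq hr hmono hℓ hlim (by positivity)
  have hc : 0 < min (ℓ / 2) (Ψ (η / 2) / δ ^ 2) := by positivity
  refine hc.trans_le (le_csInf ⟨_, δ, ⟨hδ.ne', (abs_of_pos hδ).le⟩, rfl⟩ ?_)
  rintro _ ⟨x, ⟨hx0, hxδ⟩, rfl⟩
  have hxa : 0 < |x| := abs_pos.2 hx0
  have e : Ψ x / x ^ 2 = Ψ |x| / |x| ^ 2 := by rw [← hr, sq_abs]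
  simp only [e]
  rcases lt_or_ge |x| η with h | h
  · exact (min_le_left _ _).trans (le_of_lt (hηs (Set.mem_Ioo.2 ⟨hxa, h⟩)))
  · refine (min_le_right _ _).trans ?_
    have : Ψ (η / 2) ≤ Ψ |x| := 
      hmono (by positivity : (0 : ℝ) ≤ η / 2) hxa.le (by linarith)
    gcongr
    exact hp.le.trans this

theorem tendsto_sq_mul_div (hr : ∀ x, Ψ x = Ψ |x|) (h00 : Ψ 0 = 0) {ℓ : ℝ}
    (hlim : Tendsto (fun x : ℝ => Ψ x / x ^ 2) (𝓝[>] 0) (𝓝 ℓ)) {a : ℕ → ℝ}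
    (ha_pos : ∀ n, 0 < a n) (ha : Tendsto a atTop atTop) (v : ℝ) :
    Tendsto (fun n => a n ^ 2 * Ψ (v / a n)) atTop (𝓝 (ℓ * v ^ 2)) := by
  rcases eq_or_ne v 0 with rfl | hv
  · simp [h00]
  · have h1 : Tendsto (fun n => |v| / a n) atTop (𝓝[>] 0) :=
      tendsto_nhdsWithin_iff.2 ⟨ha.const_div_atTop _,
        Eventually.of_forall fun n => div_pos (abs_pos.2 hv) (ha_pos n)⟩
    refine ((hlim.comp h1).mul_const (v ^ 2)).congr fun n => ?_
    have := ha_pos n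
    simp only [Function.comp_apply]
    rw [hr (v / a n), abs_div, abs_of_pos this, div_pow, sq_abs]
    field_simp

end Exponent

/-! ### The residual spectrum. -/

/-- The Fourier integral of `κ` with positive phase. -/
noncomputable def phaseIntegral (κ : ℝ → ℂ) (y : ℝ) : ℂ :=
  ∫ x, κ x * Complex.exp (Complex.I * (x * y : ℝ))

theorem norm_phase_mul (c : ℂ) (x : ℝ) : ‖c * Complex.exp (Complex.I * (x : ℝ))‖ = ‖c‖ := by
  rw [norm_mul, mul_comm Complex.I, Complex.norm_exp_ofReal_mul_I, mul_one]

theorem integrable_phase {κ : ℝ → ℂ} (hκ : Integrable κ) (y : ℝ) :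
    Integrable (fun x : ℝ => κ x * Complex.exp (Complex.I * (x * y : ℝ))) := by
  refine hκ.mono (hκ.aestronglyMeasurable.mul (by fun_prop))
    (ae_of_all _ fun x => (norm_phase_mul _ _).le)

theorem norm_phaseIntegral_le (κ : ℝ → ℂ) (y : ℝ) : ‖phaseIntegral κ y‖ ≤ ∫ x, ‖κ x‖ := by
  refine (norm_integral_le_integral_norm _).trans (le_of_eq ?_)
  exact integral_congr_ae (ae_of_all _ fun x => norm_phase_mul _ _)

theorem measurable_phaseIntegral {κ : ℝ → ℂ} (hκ : Measurable κ) :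
    Measurable (phaseIntegral κ) := by
  have h : StronglyMeasurable (fun p : ℝ × ℝ =>
      κ p.2 * Complex.exp (Complex.I * (p.2 * p.1 : ℝ))) :=
    Measurable.stronglyMeasurable (by fun_prop)
  exact h.integral_prod_right'.measurable

/-- The part of the spectrum of `f` that does not contribute to the limit. -/
noncomputable def residualSpectrum (f : ℝ → ℂ) (δ x : ℝ) : ℂ :=
  (((2 * Real.pi)⁻¹ : ℝ) : ℂ) * angularFourier f x -
    angularFourier f 0 * (((2 * Real.pi)⁻¹ : ℝ) : ℂ) * (Set.Ioc (-δ) δ).indicator 1 x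

section Residual

variable {f : ℝ → ℂ}

theorem measurable_residualSpectrum (hf : AEStronglyMeasurable f) (δ : ℝ) :
    Measurable (residualSpectrum f δ) := by
  unfold residualSpectrum
  have h1 := measurable_angularFourier hf
  have h2 : Measurable ((Set.Ioc (-δ) δ).indicator (1 : ℝ → ℂ)) :=
    measurable_one.indicator measurableSet_Ioc
  fun_prop

theorem integrable_indicator_window (δ : ℝ) :
    Integrable ((Set.Ioc (-δ) δ).indicator (1 : ℝ → ℂ)) :=
  (integrable_indicator_iff measurableSet_Ioc).2 (integrableOn_const (by simp))

theorem integrable_residualSpectrum (hf : Integrable (angularFourier f)) (δ : ℝ) :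
    Integrable (residualSpectrum f δ) :=
  (hf.const_mul _).sub ((integrable_indicator_window δ).const_mul _)

theorem norm_residualSpectrum_le (f : ℝ → ℂ) (δ x : ℝ) :
    ‖residualSpectrum f δ x‖ ≤ (2 * Real.pi)⁻¹ * (2 * ∫ y, ‖f y‖) := by
  have hp : (0 : ℝ) < (2 * Real.pi)⁻¹ := by positivity
  have h1 := norm_angularFourier_le f x
  have h0 := norm_angularFourier_le f 0
  have hi : ‖(Set.Ioc (-δ) δ).indicator (1 : ℝ → ℂ) x‖ ≤ 1 := by
    by_cases hx : x ∈ Set.Ioc (-δ) δ <;> simp [hx]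
  refine (norm_sub_le _ _).trans ?_
  rw [norm_mul, norm_mul, norm_mul, Complex.norm_real, Real.norm_of_nonneg hp.le]
  calc _ ≤ (2 * Real.pi)⁻¹ * (∫ y, ‖f y‖) + (∫ y, ‖f y‖) * (2 * Real.pi)⁻¹ * 1 := by gcongr
    _ = _ := by ring

theorem phaseIntegral_residualSpectrum (hf : Integrable (angularFourier f)) {δ : ℝ} (hδ : 0 ≤ δ)
    (y : ℝ) :
    phaseIntegral (residualSpectrum f δ) y =
      phaseIntegral (fun x => (((2 * Real.pi)⁻¹ : ℝ) : ℂ) * angularFourier f x) y -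
        angularFourier f 0 * (sincKernel δ y : ℂ) := by
  have h1 := integrable_phase (hf.const_mul (((2 * Real.pi)⁻¹ : ℝ) : ℂ)) y
  have h2 := integrable_phase ((integrable_indicator_window δ).const_mul
    (angularFourier f 0 * (((2 * Real.pi)⁻¹ : ℝ) : ℂ))) y
  simp only [phaseIntegral, residualSpectrum, sub_mul]
  rw [integral_sub h1 h2, ofReal_sincKernel, intervalIntegral.integral_of_le (by linarith),
    ← integral_indicator measurableSet_Ioc]
  congr 1
  rw [← mul_assoc, ← integral_const_mul]
  refine integral_congr_ae (ae_of_all _ fun x => ?_)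
  by_cases hx : x ∈ Set.Ioc (-δ) δ <;> simp [hx]

/-- Inside the window `1/Ψ` is at most a multiple of `1 / y²`, compensated by `f̂(y) - f̂(0)`.
Outside, `Ψ ≥ Ψ(δ)` and `f̂` itself is integrable. -/
theorem lintegral_residualSpectrum_ne_top {Ψ : ℝ → ℝ} (hf : Integrable (angularFourier f))
    (hf2 : Integrable (fun x : ℝ => ‖angularFourier f x - angularFourier f 0‖ / x ^ 2))
    (h0 : ∀ x, 0 ≤ Ψ x) (hpos : ∀ x, x ≠ 0 → 0 < Ψ x) (hr : ∀ x, Ψ x = Ψ |x|)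
    (hmono : MonotoneOn Ψ (Set.Ici 0)) {δ : ℝ} (hδ : 0 < δ) (hell : 0 < ellLower Ψ δ) :
    ∫⁻ y, ‖residualSpectrum f δ y‖ₑ * fullLaplace (Ψ y) ≠ ∞ := by
  have hp : (0 : ℝ) < (2 * Real.pi)⁻¹ := by positivity
  have hne : ∀ᵐ y : ℝ, y ≠ 0 := by simp [ae_iff]
  have hΨδ := hpos δ hδ.ne'
  have hi : Integrable (fun y : ℝ => (2 * Real.pi)⁻¹ * (ellLower Ψ δ)⁻¹ *
      (‖angularFourier f y - angularFourier f 0‖ / y ^ 2) +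
      (2 * Real.pi)⁻¹ * (Ψ δ)⁻¹ * ‖angularFourier f y‖) :=
    (hf2.const_mul _).add (hf.norm.const_mul _)
  refine ((lintegral_mono_ae ?_).trans_lt hi.lintegral_lt_top).ne
  filter_upwards [hne] with y hy
  have hΨy := hpos y hy
  rw [fullLaplace_eq hΨy, ← ofReal_norm, ← ENNReal.ofReal_mul (norm_nonneg _)]
  refine ENNReal.ofReal_le_ofReal ?_
  by_cases hyδ : y ∈ Set.Ioc (-δ) δ
  · have e : residualSpectrum f δ y =
        (((2 * Real.pi)⁻¹ : ℝ) : ℂ) * (angularFourier f y - angularFourier f 0) := by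
      simp only [residualSpectrum, Set.indicator_of_mem hyδ, Pi.one_apply]
      ring
    have hl := ellLower_mul_sq_le h0 (abs_le.2 ⟨hyδ.1.le, hyδ.2⟩)
    have h1 : 1 / Ψ y ≤ (ellLower Ψ δ)⁻¹ / y ^ 2 := by
      rw [inv_eq_one_div, div_div]
      exact one_div_le_one_div_of_le (by positivity) hl
    rw [e, norm_mul, Complex.norm_real, Real.norm_of_nonneg hp.le]
    calc _ ≤ (2 * Real.pi)⁻¹ * ‖angularFourier f y - angularFourier f 0‖ *
          ((ellLower Ψ δ)⁻¹ / y ^ 2) := by gcongr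
      _ = (2 * Real.pi)⁻¹ * (ellLower Ψ δ)⁻¹ *
          (‖angularFourier f y - angularFourier f 0‖ / y ^ 2) := by ring
      _ ≤ _ := le_add_of_nonneg_right (by positivity)
  · have e : residualSpectrum f δ y = (((2 * Real.pi)⁻¹ : ℝ) : ℂ) * angularFourier f y := by
      simp [residualSpectrum, Set.indicator_of_notMem hyδ]
    have hy2 : δ ≤ |y| := by
      by_contra hlt
      have := abs_lt.1 (not_le.1 hlt)
      exact hyδ ⟨this.1, this.2.le⟩
    have h1 : 1 / Ψ y ≤ (Ψ δ)⁻¹ := by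
      rw [inv_eq_one_div, hr y]
      exact one_div_le_one_div_of_le hΨδ (hmono hδ.le (abs_nonneg y) hy2)
    rw [e, norm_mul, Complex.norm_real, Real.norm_of_nonneg hp.le]
    calc _ ≤ (2 * Real.pi)⁻¹ * ‖angularFourier f y‖ * (Ψ δ)⁻¹ := by gcongr
      _ = (2 * Real.pi)⁻¹ * (Ψ δ)⁻¹ * ‖angularFourier f y‖ := by ring
      _ ≤ _ := le_add_of_nonneg_left (by positivity)

end Residual

/-! ### Decomposition along the path; moment bounds and limits. -/

namespace IsRegularLevy

variable {Ω : Type*} [mΩ : MeasurableSpace Ω] {P : Measure Ω} {Z : ℝ → Ω → ℝ} {Ψ : ℝ → ℝ}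

theorem measurable_phase_path (h : IsRegularLevy Z P Ψ) {κ : ℝ → ℂ} (hκ : Measurable κ) :
    Measurable (fun p : Ω × ℝ => phaseIntegral κ (Z p.2 p.1)) :=
  (measurable_phaseIntegral hκ).comp (h.measurable_uncurry.comp measurable_swap)

theorem integrableOn_phase_path (h : IsRegularLevy Z P Ψ) {κ : ℝ → ℂ} (hκ : Measurable κ)
    (ω : Ω) (T : ℝ) :
    Integrable (fun s => phaseIntegral κ (Z s ω)) (volume.restrict (Set.Ioc 0 T)) :=
  Integrable.of_bound ((h.measurable_phase_path hκ).comp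
    (measurable_const.prodMk measurable_id)).aestronglyMeasurable _
    (ae_of_all _ fun _ => norm_phaseIntegral_le κ _)

theorem memLp_integral_phase_path [IsProbabilityMeasure P] (h : IsRegularLevy Z P Ψ) {κ : ℝ → ℂ}
    (hκ : Measurable κ) (c : ℂ) (T : ℝ) :
    MemLp (fun ω => c * ∫ s in Set.Ioc 0 T, phaseIntegral κ (Z s ω)) 2 P := by
  have hm : StronglyMeasurable (fun ω => ∫ s in Set.Ioc 0 T, phaseIntegral κ (Z s ω)) :=
    (h.measurable_phase_path hκ).stronglyMeasurable.integral_prod_right'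
  refine MemLp.of_bound (hm.aestronglyMeasurable.const_mul c)
    (‖c‖ * ((∫ x, ‖κ x‖) * volume.real (Set.Ioc 0 T))) (ae_of_all _ fun ω => ?_)
  rw [norm_mul]
  gcongr
  exact norm_setIntegral_le_of_norm_le_const (by simp) fun s _ => norm_phaseIntegral_le κ _

/-- The additive functional of an admissible function, after removal of the singular part. -/
theorem ae_additiveFunctional_sub_eq [IsProbabilityMeasure P] (h : IsRegularLevy Z P Ψ)
    (hΨi : ∀ s, 0 < s → Integrable (fun x => Real.exp (-(s * Ψ x)))) {X : ℝ≥0 → Ω → ℝ}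
    (hX : ∀ᵐ ω ∂P, ∀ s : ℝ, Z s ω = X s.toNNReal ω) {f : ℝ → ℂ} (hf : IsAdmissible f) {δ : ℝ}
    (hδ : 0 ≤ δ) {b : ℝ} (hb : 0 < b) (t : ℝ) :
    (fun ω => additiveFunctional X f b t ω - angularFourier f 0 *
      (occupation (fun r ω => Z (b ^ 2 * r) ω / b) (sincKernel (b * δ)) (t ^ 2) ω : ℂ)) =ᵐ[P]
    fun ω => (b : ℂ)⁻¹ * ∫ s in Set.Ioc 0 (t ^ 2 * b ^ 2),
      phaseIntegral (residualSpectrum f δ) (Z s ω) := by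
  have hfi : Integrable f := memLp_one_iff_integrable.1 hf.memLp_one
  have hm := measurable_angularFourier hfi.aestronglyMeasurable
  have hT : 0 ≤ t ^ 2 * b ^ 2 := by positivity
  filter_upwards [hX, h.ae_integral_comp_eq hΨi
    (ae_eq_integral_angularFourier hfi hf.fourier_integrable) (t ^ 2 * b ^ 2)] with ω h1 h2
  have e1 : additiveFunctional X f b t ω = (b : ℂ)⁻¹ * ∫ s in Set.Ioc 0 (t ^ 2 * b ^ 2),
      phaseIntegral (fun x => (((2 * Real.pi)⁻¹ : ℝ) : ℂ) * angularFourier f x) (Z s ω) := by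
    rw [additiveFunctional, intervalIntegral.integral_of_le hT]
    simp_rw [← h1]
    rw [integral_congr_ae h2]
    rfl
  have hs : Integrable (fun s => (sincKernel δ (Z s ω) : ℂ))
      (volume.restrict (Set.Ioc 0 (t ^ 2 * b ^ 2))) := by
    have := h.intervalIntegrable_comp (continuous_sincKernel δ).measurable (abs_sincKernel_le δ) ω
      0 (t ^ 2 * b ^ 2)
    exact ((intervalIntegrable_iff_integrableOn_Ioc_of_le hT).1 this).ofReal
  simp_rw [phaseIntegral_residualSpectrum hf.fourier_integrable hδ]
  rw [e1, occupation_rescale Z hb, integral_sub (h.integrableOn_phase_path (by fun_prop) ω _)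
    (hs.const_mul _), integral_const_mul, integral_complex_ofReal, occupation, mul_comm (b ^ 2),
    intervalIntegral.integral_of_le hT]
  push_cast
  ring

/-- Comparison with the Gaussian chain of length `2k` from frequency zero, with budget `M = 2k`. At
even order `Γ(1 + k) = k!`, which gives the stated quotient of factorials. -/
theorem integral_occupation_pow_two_mul_le [IsProbabilityMeasure P] (h : IsRegularLevy Z P Ψ)
    (hΨ : Measurable Ψ) (hΨ0 : ∀ x, 0 ≤ Ψ x) {d c : ℝ} (hd : 0 ≤ d) (hc : 0 < c) (k : ℕ)
    (hle : ∀ v, |v| ≤ (2 * k : ℕ) * d → c * v ^ 2 ≤ Ψ v) {t : ℝ} (ht : 0 < t) :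
    ∫ ω, occupation Z (sincKernel d) (t ^ 2) ω ^ (2 * k) ∂P ≤
      (t ^ 2 / (4 * c)) ^ k * ((Nat.factorial (2 * k) : ℝ) / (Nat.factorial k : ℝ)) := by
  have h1 := chainKernel_le_chainKernel (Φ' := fun v => c * v ^ 2) hd measurableSet_Ioc
    (fun x (hx : x ∈ Set.Ioc (-d) d) => abs_le.2 ⟨hx.1.le, hx.2⟩) hle le_rfl
    (sq_nonneg t) (v := 0) (by simp)
  rw [chainKernel_gaussian_zero hc _ (by positivity : 0 < t ^ 2)] at h1
  rw [h.integral_occupation_pow hΨ hΨ0 hd _ (sq_nonneg t)]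
  have hΓ : Real.Gamma (1 + ((2 * k : ℕ) : ℝ) / 2) = (Nat.factorial k : ℝ) := by
    rw [← Real.Gamma_nat_eq_factorial]
    congr 1
    push_cast
    ring
  have hpow : (t ^ 2) ^ (((2 * k : ℕ) : ℝ) / 2) = (t ^ 2) ^ k := by
    rw [← Real.rpow_natCast (t ^ 2) k]
    congr 1
    push_cast
    ring
  have hsq : (1 / (2 * √c)) ^ (2 * k) = (1 / (4 * c)) ^ k := by
    rw [pow_mul, div_pow, mul_pow, Real.sq_sqrt hc.le]
    norm_num
  rw [hΓ, hpow, hsq] at h1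
  have h2 := ENNReal.toReal_mono ENNReal.ofReal_ne_top h1
  rw [ENNReal.toReal_ofReal (by positivity)] at h2
  calc _ ≤ (Nat.factorial (2 * k) : ℝ) *
        ((1 / (4 * c)) ^ k * (t ^ 2) ^ k / (Nat.factorial k : ℝ)) := by gcongr
    _ = _ := by
        rw [← mul_pow, one_div_mul_eq_div]
        ring

/-- The moments of the rescaled functionals converge. -/
theorem tendsto_integral_occupation_pow [IsProbabilityMeasure P] {Y : ℕ → ℝ → Ω → ℝ}
    {Φ : ℕ → ℝ → ℝ} (h : ∀ n, IsRegularLevy (Y n) P (Φ n)) (hΦm : ∀ n, Measurable (Φ n))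
    (hΦ0 : ∀ n x, 0 ≤ Φ n x) {d : ℕ → ℝ} (hd0 : ∀ n, 0 ≤ d n) (hd : Tendsto d atTop atTop)
    {b : ℝ} (hb : 0 < b) (hlim : ∀ v, Tendsto (fun n => Φ n v) atTop (𝓝 (b * v ^ 2)))
    (hlow : ∀ M : ℕ, 1 ≤ M → ∃ c, 0 < c ∧ ∀ n v, |v| ≤ M * d n → c * v ^ 2 ≤ Φ n v)
    (k : ℕ) {t : ℝ} (ht : 0 < t) :
    Tendsto (fun n => ∫ ω, occupation (Y n) (sincKernel (d n)) (t ^ 2) ω ^ k ∂P) atTop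
      (𝓝 ((t / (2 * √b)) ^ k * ((Nat.factorial k : ℝ) / Real.Gamma (1 + (k : ℝ) / 2)))) := by
  have h1 := tendsto_chainKernel hΦm hd hb hlim hlow k (sq_nonneg t) 0
  rw [chainKernel_gaussian_zero hb _ (by positivity : 0 < t ^ 2)] at h1
  have hΓ : 0 < Real.Gamma (1 + (k : ℝ) / 2) := Real.Gamma_pos_of_pos (by positivity)
  have h2 := ((ENNReal.tendsto_toReal ENNReal.ofReal_ne_top).comp h1).const_mul
    (Nat.factorial k : ℝ)
  rw [ENNReal.toReal_ofReal (by positivity)] at h2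
  have hpow : (t ^ 2) ^ ((k : ℝ) / 2) = t ^ k := by
    rw [← Real.rpow_natCast t 2, ← Real.rpow_mul ht.le, ← Real.rpow_natCast t k]
    congr 1
    push_cast
    ring
  rw [hpow] at h2
  convert h2 using 2
  · exact (h _).integral_occupation_pow (hΦm _) (hΦ0 _) (hd0 _) k (sq_nonneg t)
  · rw [div_eq_mul_one_div t, mul_pow]
    ring

end IsRegularLevy

/-! ### Assembly of the main theorem. -/

theorem theorem1p1 {Ω : Type*} [MeasurableSpace Ω] (P : Measure Ω) [IsProbabilityMeasure P]
    (X : ℝ≥0 → Ω → ℝ) (hX : IsLevyProcess X P) (hXsymm : IsSymmetricProcess X P)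
    (Ψ : ℝ → ℝ) (hXΨ : HasCharExponent X P Ψ)
    (hΨ_radial : ∀ x, Ψ x = Ψ |x|) (hΨ_nonneg : ∀ x, 0 ≤ Ψ x)
    (hΨ_mono : MonotoneOn Ψ (Set.Ici 0))
    (ℓ : ℝ) (hℓ : 0 < ℓ)
    (hΨ_zero : Tendsto (fun x : ℝ => Ψ x / x ^ 2) (𝓝[>] 0) (𝓝 ℓ))
    (hΨ_HW : Tendsto (fun x : ℝ => Ψ x / Real.log (|x| + 1)) atTop atTop)
    (hΨ_int : Integrable (fun x : ℝ => 1 / (1 + Ψ x)) volume)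
    (a : ℕ → ℝ) (ha_pos : ∀ n, 0 < a n) (ha_mono : Monotone a)
    (ha_top : Tendsto a atTop atTop)
    (f : ℝ → ℂ) (hf : IsAdmissible f) (t : ℝ) (ht : 0 < t) :
    ∃ (I₁ : ℝ → ℕ → Ω → ℂ) (I₂ : ℝ → ℕ → Ω → ℝ),
      (∀ δ : ℝ, 0 < δ →
        -- the decomposition
        (∀ n ω, additiveFunctional X f (a n) t ω =
          I₁ δ n ω + angularFourier f 0 * (I₂ δ n ω : ℂ)) ∧
        -- the first part converges to zero in `L²`
        (∀ n, MemLp (I₁ δ n) 2 P) ∧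
        Tendsto (fun n => eLpNorm (I₁ δ n) 2 P) atTop (𝓝 0) ∧
        -- the bound on the even moments, uniformly in `n`
        (∀ k : ℕ, 1 ≤ k → ∀ n,
          Integrable (fun ω => |I₂ δ n ω| ^ (2 * k)) P ∧
          ∫ ω, |I₂ δ n ω| ^ (2 * k) ∂P ≤
            (t ^ 2 / (4 * ellLower Ψ (2 * (k : ℝ) * δ))) ^ k *
              ((Nat.factorial (2 * k) : ℝ) / (Nat.factorial k : ℝ))) ∧
        -- uniform integrability of all powers
        (∀ k : ℕ, 1 ≤ k → UniformIntegrable (fun n ω => I₂ δ n ω ^ k) 1 P)) ∧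
      -- the limits of the moments
      (∀ k : ℕ, 1 ≤ k →
        Tendsto (fun δ : ℝ => liminf (fun n => ∫ ω, I₂ δ n ω ^ k ∂P) atTop) (𝓝[>] 0)
          (𝓝 ((t / (2 * √ℓ)) ^ k * ((Nat.factorial k : ℝ) / Real.Gamma (1 + (k : ℝ) / 2)))) ∧
        Tendsto (fun δ : ℝ => limsup (fun n => ∫ ω, I₂ δ n ω ^ k ∂P) atTop) (𝓝[>] 0)
          (𝓝 ((t / (2 * √ℓ)) ^ k * ((Nat.factorial k : ℝ) / Real.Gamma (1 + (k : ℝ) / 2))))) := by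
  obtain ⟨Z, hZ, hZX⟩ := hX.exists_isRegularLevy hXΨ hΨ_radial
  have hΨm : Measurable Ψ := measurable_of_radial_monotoneOn hΨ_radial hΨ_mono
  have hΨe : ∀ x, Ψ (-x) = Ψ x := fun x => by rw [hΨ_radial, abs_neg, ← hΨ_radial]
  have hpos : ∀ x, x ≠ 0 → 0 < Ψ x := fun x hx =>
    pos_of_tendsto_div_sq hΨ_radial hΨ_mono hℓ hΨ_zero hx
  have hell : ∀ δ, 0 < δ → 0 < ellLower Ψ δ := fun δ hδ =>
    ellLower_pos hΨ_radial hΨ_mono hℓ hΨ_zero hδ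
  have hΨ00 : Ψ 0 = 0 := by
    have := hZ.charFun 1 0 zero_le_one
    simp only [zero_mul, Complex.ofReal_zero, mul_zero, Complex.exp_zero, one_mul,
      integral_const, probReal_univ, one_smul] at this
    have h1 : Real.exp (-Ψ 0) = 1 := by exact_mod_cast this.symm
    rw [Real.exp_eq_one_iff] at h1
    linarith
  have hΨi : ∀ s, 0 < s → Integrable (fun x => Real.exp (-(s * Ψ x))) := fun s hs =>
    integrable_exp_neg_mul_of_tendsto_div_log hΨm hΨ_radial hΨ_nonneg hΨ_HW hs
  have hfm := (memLp_one_iff_integrable.1 hf.memLp_one).aestronglyMeasurable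
  have hres := fun n => hZ.rescale (ha_pos n)
  have hΦm : ∀ n, Measurable (fun v => a n ^ 2 * Ψ (v / a n)) := fun n => by fun_prop
  have hΦ0 : ∀ n v, 0 ≤ a n ^ 2 * Ψ (v / a n) := fun n v =>
    mul_nonneg (sq_nonneg _) (hΨ_nonneg _)
  -- The window `M a(n) δ` for the rescaled exponent is the window `M δ` for `Ψ`, so the quadratic
  -- constant does not depend on `n`.
  have hΦlow : ∀ (M n : ℕ) (δ v : ℝ), |v| ≤ M * (a n * δ) →
      ellLower Ψ (M * δ) * v ^ 2 ≤ a n ^ 2 * Ψ (v / a n) := by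
    intro M n δ v hv
    have han := ha_pos n
    have h1 : |v / a n| ≤ M * δ := by
      rw [abs_div, abs_of_pos han, div_le_iff₀ han]
      linarith
    have h2 := mul_le_mul_of_nonneg_left (ellLower_mul_sq_le hΨ_nonneg h1) (sq_nonneg (a n))
    refine le_trans (le_of_eq ?_) h2
    field_simp
  let I₂ : ℝ → ℕ → Ω → ℝ := fun δ n =>
    occupation (fun r ω => Z (a n ^ 2 * r) ω / a n) (sincKernel (a n * δ)) (t ^ 2)
  have hI₂m : ∀ δ n, Measurable (I₂ δ n) := fun δ n =>
    (hres n).measurable_occupation (continuous_sincKernel _).measurable (sq_nonneg t)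
  have hI₂int : ∀ δ n (j : ℕ), Integrable (fun ω => I₂ δ n ω ^ j) P := fun δ n j => by
    refine Integrable.of_bound ((hI₂m δ n).pow_const j).aestronglyMeasurable
      (((2 * Real.pi)⁻¹ * |a n * δ - -(a n * δ)| * t ^ 2) ^ j) (ae_of_all _ fun ω => ?_)
    rw [norm_pow, Real.norm_eq_abs]
    gcongr
    exact IsRegularLevy.abs_occupation_le (abs_sincKernel_le _) (sq_nonneg t) ω
  have hbound : ∀ δ, 0 < δ → ∀ k : ℕ, 1 ≤ k → ∀ n, ∫ ω, I₂ δ n ω ^ (2 * k) ∂P ≤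
      (t ^ 2 / (4 * ellLower Ψ (2 * (k : ℝ) * δ))) ^ k *
        ((Nat.factorial (2 * k) : ℝ) / (Nat.factorial k : ℝ)) := by
    intro δ hδ k hk n
    have hk0 : (0 : ℝ) < k := by exact_mod_cast hk
    refine (hres n).integral_occupation_pow_two_mul_le (hΦm n) (hΦ0 n)
      (mul_nonneg (ha_pos n).le hδ.le) (hell _ (by positivity)) k (fun v hv => ?_) ht
    have := hΦlow (2 * k) n δ v hv
    push_cast at this
    exact this
  have hae := fun δ (hδ : 0 < δ) n =>
    hZ.ae_additiveFunctional_sub_eq hΨi hZX hf hδ.le (ha_pos n) t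
  -- The limit is the same for every `δ`, so the functions of `δ` in the final statement are
  -- constant on `δ > 0`.
  have hlimit : ∀ (k : ℕ) δ, 0 < δ → Tendsto (fun n => ∫ ω, I₂ δ n ω ^ k ∂P) atTop
      (𝓝 ((t / (2 * √ℓ)) ^ k * ((Nat.factorial k : ℝ) / Real.Gamma (1 + (k : ℝ) / 2)))) := by
    intro k δ hδ
    refine IsRegularLevy.tendsto_integral_occupation_pow hres hΦm hΦ0
      (fun n => mul_nonneg (ha_pos n).le hδ.le) (ha_top.atTop_mul_const hδ) hℓ
      (tendsto_sq_mul_div hΨ_radial hΨ00 hΨ_zero ha_pos ha_top) (fun M hM => ?_) k ht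
    have hM0 : (0 : ℝ) < M := by exact_mod_cast hM
    exact ⟨ellLower Ψ (M * δ), hell _ (by positivity), fun n v hv => hΦlow M n δ v hv⟩
  -- The first part is defined by subtraction, so the decomposition holds at every `ω`; its spectral
  -- formula, valid almost surely, serves for the `L²` claims.
  refine ⟨fun δ n ω => additiveFunctional X f (a n) t ω - angularFourier f 0 * (I₂ δ n ω : ℂ),
    I₂, fun δ hδ => ⟨fun n ω => by ring, fun n => ?_, ?_, fun k hk n => ?_, fun k hk => ?_⟩,
    fun k _ => ?_⟩
  · exact (hZ.memLp_integral_phase_path (measurable_residualSpectrum hfm δ) _ _).ae_eq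
      (hae δ hδ n).symm
  · have h1 := hZ.tendsto_lintegral_enorm_sq hΨm hΨe hpos hΨ_int
      (measurable_residualSpectrum hfm δ) (integrable_residualSpectrum hf.fourier_integrable δ)
      (norm_residualSpectrum_le f δ) (lintegral_residualSpectrum_ne_top hf.fourier_integrable
        hf.fourier_sub_integrable hΨ_nonneg hpos hΨ_radial hΨ_mono hδ (hell δ hδ)) ha_top t
    have h2 := h1.ennrpow_const (1 / 2)
    rw [ENNReal.zero_rpow_of_pos (by norm_num)] at h2
    refine h2.congr fun n => ?_
    rw [eLpNorm_congr_ae (hae δ hδ n), eLpNorm_eq_lintegral_rpow_enorm_toReal (by norm_num)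
      (by norm_num)]
    simp only [ENNReal.toReal_ofNat, ENNReal.rpow_ofNat]
    rfl
  · simp_rw [(even_two_mul k).pow_abs]
    exact ⟨hI₂int δ n _, hbound δ hδ k hk n⟩
  -- The second moment of the `k`-th power is the `2k`-th moment bounded above.
  · refine uniformIntegrable_of_integral_sq_le (fun n => (hI₂int δ n k).aestronglyMeasurable)
      (C := (t ^ 2 / (4 * ellLower Ψ (2 * (k : ℝ) * δ))) ^ k *
        ((Nat.factorial (2 * k) : ℝ) / (Nat.factorial k : ℝ))) (fun n => ?_) fun n => ?_
    · simp_rw [← pow_mul]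
      exact hI₂int δ n _
    · simp_rw [← pow_mul, mul_comm k 2]
      exact hbound δ hδ k hk n
  · constructor
    · refine tendsto_const_nhds.congr' ?_
      filter_upwards [self_mem_nhdsWithin] with δ hδ
      exact (hlimit k δ hδ).liminf_eq.symm
    · refine tendsto_const_nhds.congr' ?_
      filter_upwards [self_mem_nhdsWithin] with δ hδ
      exact (hlimit k δ hδ).limsup_eq.symm
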